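/- **Setting.** Let $\hat{\mathsf G}$ be a finite group with a homomorphism $\pi:\hat{\mathsf G}\to\mathbb Z_2=\{\pm1\}$, and let $\mathbb C^\times_\pi$ be $\mathbb C^\times$ with $g$ acting by $z\mapsto z^{\pi(g)}$. A *twisted $n$-cocycle* $\hat\lambda\in Z^n(B\hat{\mathsf G};\mathbb C^\times_\pi)$ is an inhomogeneous group $n$-cocycle of $\hat{\mathsf G}$ with coefficients in $\mathbb C^\times_\pi$. For a smooth manifold $M$ (possibly with boundary) let $\mathrm{or}_M\to M$ be its orientation double cover. Let $\mathcal Bun^{\mathrm{or}}_{\hat{\mathsf G}}(M)$ be the groupoid of pairs $(P,\epsilon)$, where $P\to M$ is a principal $\hat{\mathsf G}$-bundle and $\epsilon:P\times_{\hat{\mathsf G}}\mathbb Z_2\to\mathrm{or}_M$ is an isomorphism of double covers of $M$; morphisms are bundle morphisms compatible with $\epsilon$. Cochains on a groupoid are $\mathbb C^\times$-valued functions on the composable strings of its nerve. Their differential is $(d\varphi)(\Delta)=(-1)^{k+1}\varphi(\partial\Delta)$ for a $k$-cochain $\varphi$ and $\partial\Delta=\sum_i(-1)^i\partial_i\Delta$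 (the group of values being written additively). For compact $M$, fix a *fundamental chain* $c_M$: a singular chain of degree $\dim M$ with coefficients in the local system $\mathbb Z_{\mathrm{or}_M}=\mathrm{or}_M\times_{\mathbb Z_2}\mathbb Z$, which is a cycle relative to $\partial M$ and represents the canonical generator of $H_{\dim M}(M,M\setminus\{x\};\mathbb Z_{\mathrm{or}_M})$ for every interior point $x$. Choose for each $(P,\epsilon)$ and each $x\in M$ a point of the fibre $P_x$. Comparing the chosen points along edges gives the classifying map $\mathrm{ev}$ of the universal bundle over $\mathcal Bun^{\mathrm{or}}_{\hat{\mathsf G}}(M)\times M$ to the nerve of $\hat{\mathsf G}$, and by means of $\epsilon$ the pull-back $\mathrm{ev}^*\hat\lambda$ takes values in $\mathbb C^\times$ twisted by $\mathrm{or}_M$. The *orientation twisted transgression* of $\hat\lambda$ is the $(n-\dim M)$-cochain $$\tau_M^{\mathrm{or}}(\hat\lambda)(\Delta)=\langle \mathrm{ev}^*\hat\lambda,\ \Delta\times c_M\rangle\in\mathbb C^\times$$ on $\mathcal Bun^{\mathrm{or}}_{\hat{\mathsf G}}(M)$, where $\times$ is the Eilenberg–Zilber (shuffle) cross product. **Proposition.**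 Let $\hat\lambda\in Z^n(B\hat{\mathsf G};\mathbb C_\pi^\times)$. 1. Let $M$ be a compact smooth manifold with boundary $j:\partial M\hookrightarrow M$. Let $c_M$, $c_{\partial M}$ be fundamental chains and $j^*\mathrm{or}_M\cong\mathrm{or}_{\partial M}$ an isomorphism of double covers with $\partial c_M=j_*c_{\partial M}$, and let the choices of fibre points on $\partial M$ and on $M$ be compatible under the resulting restriction functor $j^*:\mathcal Bun^{\mathrm{or}}_{\hat{\mathsf G}}(M)\to\mathcal Bun^{\mathrm{or}}_{\hat{\mathsf G}}(\partial M)$. If $n\ge\dim M$, then $$d\,\tau_M^{\mathrm{or}}(\hat\lambda)=-\,j^*\tau_{\partial M}^{\mathrm{or}}(\hat\lambda)$$ as $(n-\dim M+1)$-cochains on $\mathcal Bun_{\hat{\mathsf G}}^{\mathrm{or}}(M)$. If $n=\dim M-1$, where there is no left-hand side, then $j^*\tau_{\partial M}^{\mathrm{or}}(\hat\lambda)=0$. 2. In particular, let $M$ be a closed smooth manifold with $\dim M\le n$. Then, for every fundamental chain and every choice of fibre points, $d\,\tau_M^{\mathrm{or}}(\hat\lambda)=0$, so that $\tau_M^{\mathrm{or}}$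 restricts to a map $$\tau_M^{\mathrm{or}}:Z^\bullet(B\hat{\mathsf G};\mathbb C^\times_\pi)\to Z^{\bullet-\dim M}(\mathcal Bun_{\hat{\mathsf G}}^{\mathrm{or}}(M);\mathbb C^\times).$$ -/

import Mathlib

universe u

open scoped Manifold ContDiff Topology

namespace OrTransgression

noncomputable section

/-- A double cover of a space `X`: a surjective covering map all of whose fibres consist of exactly
two points, together with its deck involution `swap` (the action of `-1 ∈ ℤ₂`). -/
structure DoubleCover (X : Type u) [TopologicalSpace X] where
  total : Type u
  [top : TopologicalSpace total]
  proj : total → X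
  isCovering : IsCoveringMap proj
  surjective : Function.Surjective proj
  swap : total → total
  continuous_swap : Continuous swap
  swap_ne : ∀ q, swap q ≠ q
  proj_eq_iff : ∀ q q', proj q = proj q' ↔ q' = q ∨ q' = swap q

attribute [instance] DoubleCover.top

namespace DoubleCover

variable {X : Type u} [TopologicalSpace X] (D : DoubleCover X)

theorem proj_swap (q : D.total) : D.proj (D.swap q) = D.proj q :=
  ((D.proj_eq_iff q (D.swap q)).2 (Or.inr rfl)).symm

theorem swap_swap (q : D.total) : D.swap (D.swap q) = q := by
  rcases (D.proj_eq_iff (D.swap q) q).1 (D.proj_swap q) with h | h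
  · exact absurd h.symm (D.swap_ne q)
  · exact h.symm

end DoubleCover

section OrientationCover

variable {m : ℕ} {H : Type*} [TopologicalSpace H]
  (I : ModelWithCorners ℝ (EuclideanSpace ℝ (Fin m)) H)
  (M : Type u) [TopologicalSpace M] [ChartedSpace H M]

/-- Points of the orientation double cover of `M`: a point of `M` together with an orientation of
the tangent space at it. -/
structure OrPoint where
  pt : M
  ori : Orientation ℝ (TangentSpace I pt) (Fin m)

variable [IsManifold I 1 M]

variable {M} in
/-- The isomorphism `T_x M ≃ ℝ^m` given by the chart at `x₀`, for `x` in the domain of that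
chart. -/
def tangentChart (x₀ : M) (x : (trivializationAt (EuclideanSpace ℝ (Fin m)) (TangentSpace I) x₀).baseSet) :
    TangentSpace I (x : M) ≃ₗ[ℝ] EuclideanSpace ℝ (Fin m) :=
  ((trivializationAt (EuclideanSpace ℝ (Fin m)) (TangentSpace I) x₀).continuousLinearEquivAt ℝ
    (x : M) x.2).toLinearEquiv

variable {M} in
/-- The local section of the orientation cover over the domain of the chart at `x₀` which is
the orientation `o` of `ℝ^m` in that chart. -/
def orSection (x₀ : M) (o : Orientation ℝ (EuclideanSpace ℝ (Fin m)) (Fin m))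
    (x : (trivializationAt (EuclideanSpace ℝ (Fin m)) (TangentSpace I) x₀).baseSet) : OrPoint I M :=
  ⟨x, Orientation.map (Fin m) (tangentChart I x₀ x).symm o⟩

/-- The topology of the orientation cover: the finest one for which the local sections which are
constant in a chart are continuous. -/
instance : TopologicalSpace (OrPoint I M) :=
  ⨆ (x₀ : M) (o : Orientation ℝ (EuclideanSpace ℝ (Fin m)) (Fin m)),
    TopologicalSpace.coinduced (orSection I x₀ o) inferInstance

variable {I M}

theorem OrPoint.isOpen_iff (W : Set (OrPoint I M)) :
    IsOpen W ↔ ∀ x₀ o, IsOpen (orSection I x₀ o ⁻¹' W) := by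
  simp only [isOpen_iSup_iff, isOpen_coinduced]

theorem OrPoint.continuous_iff {Y : Type*} [TopologicalSpace Y] (f : OrPoint I M → Y) :
    Continuous f ↔ ∀ x₀ o, Continuous (f ∘ orSection I x₀ o) := by
  simp only [continuous_iSup_dom, continuous_coinduced_dom]

theorem continuous_orSection (x₀ : M) (o : Orientation ℝ (EuclideanSpace ℝ (Fin m)) (Fin m)) :
    Continuous (orSection I x₀ o) := by
  refine continuous_def.2 fun W hW => (OrPoint.isOpen_iff W).1 hW x₀ o

theorem OrPoint.continuous_pt : Continuous (OrPoint.pt : OrPoint I M → M) := by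
  rw [OrPoint.continuous_iff]
  intro x₀ o
  exact continuous_subtype_val

theorem orSection_neg (x₀ : M) (o : Orientation ℝ (EuclideanSpace ℝ (Fin m)) (Fin m))
    (x : (trivializationAt (EuclideanSpace ℝ (Fin m)) (TangentSpace I) x₀).baseSet) :
    orSection I x₀ (-o) x = ⟨x, -(orSection I x₀ o x).ori⟩ :=
  congrArg (OrPoint.mk (x : M)) (Orientation.map_neg (tangentChart I x₀ x).symm o)

theorem OrPoint.continuous_swap :
    Continuous (fun q : OrPoint I M => (⟨q.pt, -q.ori⟩ : OrPoint I M)) := by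
  rw [OrPoint.continuous_iff]
  intro x₀ o
  have : (fun q : OrPoint I M => (⟨q.pt, -q.ori⟩ : OrPoint I M)) ∘ orSection I x₀ o
      = orSection I x₀ (-o) := by
    funext x
    rw [orSection_neg]
    rfl
  rw [this]
  exact continuous_orSection x₀ (-o)

/-- The orientation `q` read in the chart at `x₀`. -/
def orCoord (x₀ : M) (q : OrPoint I M)
    (hq : q.pt ∈ (trivializationAt (EuclideanSpace ℝ (Fin m)) (TangentSpace I) x₀).baseSet) :
    Orientation ℝ (EuclideanSpace ℝ (Fin m)) (Fin m) :=
  Orientation.map (Fin m) (tangentChart I x₀ ⟨q.pt, hq⟩) q.ori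

theorem orSection_orCoord (x₀ : M) (q : OrPoint I M)
    (hq : q.pt ∈ (trivializationAt (EuclideanSpace ℝ (Fin m)) (TangentSpace I) x₀).baseSet) :
    orSection I x₀ (orCoord x₀ q hq) ⟨q.pt, hq⟩ = q :=
  congrArg (OrPoint.mk q.pt)
    (Equiv.symm_apply_apply (Orientation.map (Fin m) (tangentChart I x₀ ⟨q.pt, hq⟩)) q.ori)

theorem orCoord_orSection (x₀ : M) (o : Orientation ℝ (EuclideanSpace ℝ (Fin m)) (Fin m))
    (x : (trivializationAt (EuclideanSpace ℝ (Fin m)) (TangentSpace I) x₀).baseSet) :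
    orCoord x₀ (orSection I x₀ o x) x.2 = o :=
  Equiv.apply_symm_apply (Orientation.map (Fin m) (tangentChart I x₀ x)) o

theorem orientation_map_trans {V₁ V₂ V₃ : Type*} [AddCommGroup V₁] [Module ℝ V₁] [AddCommGroup V₂]
    [Module ℝ V₂] [AddCommGroup V₃] [Module ℝ V₃] {ι : Type*} (e : V₁ ≃ₗ[ℝ] V₂) (e' : V₂ ≃ₗ[ℝ] V₃)
    (o : Orientation ℝ V₁ ι) :
    Orientation.map ι e' (Orientation.map ι e o) = Orientation.map ι (e.trans e') o := by
  induction o using Module.Ray.ind with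
  | h v hv => rfl

theorem orientation_eq_or_eq_neg (o o' : Orientation ℝ (EuclideanSpace ℝ (Fin m)) (Fin m)) :
    o = o' ∨ o = -o' :=
  Orientation.eq_or_eq_neg o o' (by simp)

/-- The orientation in the chart at `x₀` of a section which is constant in the chart at `x₁` is
locally constant. -/
theorem isOpen_orCoord_eq (x₀ x₁ : M) (o o' : Orientation ℝ (EuclideanSpace ℝ (Fin m)) (Fin m)) :
    IsOpen {x : M | ∃ (h₀ : x ∈ (trivializationAt (EuclideanSpace ℝ (Fin m)) (TangentSpace I) x₀).baseSet)
      (h₁ : x ∈ (trivializationAt (EuclideanSpace ℝ (Fin m)) (TangentSpace I) x₁).baseSet),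
      orCoord x₀ (orSection I x₁ o ⟨x, h₁⟩) h₀ = o'} := by
  set e₀ := trivializationAt (EuclideanSpace ℝ (Fin m)) (TangentSpace I) x₀ with he₀
  set e₁ := trivializationAt (EuclideanSpace ℝ (Fin m)) (TangentSpace I) x₁ with he₁
  have key : ∀ x (h₀ : x ∈ e₀.baseSet) (h₁ : x ∈ e₁.baseSet),
      orCoord x₀ (orSection I x₁ o ⟨x, h₁⟩) h₀
        = Orientation.map (Fin m) (e₁.coordChangeL ℝ e₀ x).toLinearEquiv o := by
    intro x h₀ h₁
    have h2 := Bundle.Trivialization.coe_coordChangeL' (R := ℝ) e₁ e₀ ⟨h₁, h₀⟩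
    rw [h2]
    exact orientation_map_trans (tangentChart I x₁ ⟨x, h₁⟩).symm (tangentChart I x₀ ⟨x, h₀⟩) o
  have hdet : ContinuousOn (fun x => (e₁.coordChangeL ℝ e₀ x :
      EuclideanSpace ℝ (Fin m) →L[ℝ] EuclideanSpace ℝ (Fin m)).det) (e₁.baseSet ∩ e₀.baseSet) :=
    ContinuousLinearMap.continuous_det.comp_continuousOn (continuousOn_coordChange ℝ e₁ e₀)
  have hopen : IsOpen (e₁.baseSet ∩ e₀.baseSet) := e₁.open_baseSet.inter e₀.open_baseSet
  have hcard : Fintype.card (Fin m) = Module.finrank ℝ (EuclideanSpace ℝ (Fin m)) := by simp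
  rcases Orientation.eq_or_eq_neg o' o hcard with rfl | rfl
  · have : {x : M | ∃ (h₀ : x ∈ e₀.baseSet) (h₁ : x ∈ e₁.baseSet),
        orCoord x₀ (orSection I x₁ o' ⟨x, h₁⟩) h₀ = o'}
        = (e₁.baseSet ∩ e₀.baseSet) ∩ (fun x => (e₁.coordChangeL ℝ e₀ x :
      EuclideanSpace ℝ (Fin m) →L[ℝ] EuclideanSpace ℝ (Fin m)).det) ⁻¹' Set.Ioi 0 := by
      ext x
      constructor
      · rintro ⟨h₀, h₁, h⟩
        rw [key, Orientation.map_eq_iff_det_pos _ _ hcard] at h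
        exact ⟨⟨h₁, h₀⟩, h⟩
      · rintro ⟨⟨h₁, h₀⟩, h⟩
        refine ⟨h₀, h₁, ?_⟩
        rw [key, Orientation.map_eq_iff_det_pos _ _ hcard]
        exact h
    rw [this]
    exact hdet.isOpen_inter_preimage hopen isOpen_Ioi
  · have : {x : M | ∃ (h₀ : x ∈ e₀.baseSet) (h₁ : x ∈ e₁.baseSet),
        orCoord x₀ (orSection I x₁ o ⟨x, h₁⟩) h₀ = -o}
        = (e₁.baseSet ∩ e₀.baseSet) ∩ (fun x => (e₁.coordChangeL ℝ e₀ x :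
      EuclideanSpace ℝ (Fin m) →L[ℝ] EuclideanSpace ℝ (Fin m)).det) ⁻¹' Set.Iio 0 := by
      ext x
      constructor
      · rintro ⟨h₀, h₁, h⟩
        rw [key, Orientation.map_eq_neg_iff_det_neg _ _ hcard] at h
        exact ⟨⟨h₁, h₀⟩, h⟩
      · rintro ⟨⟨h₁, h₀⟩, h⟩
        refine ⟨h₀, h₁, ?_⟩
        rw [key, Orientation.map_eq_neg_iff_det_neg _ _ hcard]
        exact h
    rw [this]
    exact hdet.isOpen_inter_preimage hopen isOpen_Iio

theorem OrPoint.isCoveringMap_pt : IsCoveringMap (OrPoint.pt : OrPoint I M → M) := by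
  intro x₀
  let : TopologicalSpace (Orientation ℝ (EuclideanSpace ℝ (Fin m)) (Fin m)) := ⊥
  have : DiscreteTopology (Orientation ℝ (EuclideanSpace ℝ (Fin m)) (Fin m)) := ⟨rfl⟩
  set e₀ := trivializationAt (EuclideanSpace ℝ (Fin m)) (TangentSpace I) x₀ with he₀
  refine IsEvenlyCovered.to_isEvenlyCovered_preimage
    (I := Orientation ℝ (EuclideanSpace ℝ (Fin m)) (Fin m))
    ⟨inferInstance, e₀.baseSet, FiberBundle.mem_baseSet_trivializationAt' x₀, e₀.open_baseSet,
      e₀.open_baseSet.preimage OrPoint.continuous_pt, ?_⟩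
  refine ⟨{ toFun := fun q => (⟨q.1.pt, q.2⟩, orCoord x₀ q.1 q.2)
            invFun := fun y => ⟨orSection I x₀ y.2 y.1, y.1.2⟩
            left_inv := fun q => Subtype.ext (orSection_orCoord x₀ q.1 q.2)
            right_inv := fun y => Prod.ext rfl (orCoord_orSection x₀ y.2 y.1)
            continuous_toFun := ?_
            continuous_invFun := ?_ }, fun q => rfl⟩
  · refine Continuous.prodMk ((OrPoint.continuous_pt.comp continuous_subtype_val).subtype_mk _) ?_
    rw [continuous_discrete_rng]
    intro o'
    refine ⟨{q : OrPoint I M | ∃ h : q.pt ∈ e₀.baseSet, orCoord (I := I) x₀ q h = o'}, ?_, ?_⟩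
    · refine (OrPoint.isOpen_iff (I := I) (M := M) _).2 ?_
      intro x₁ o
      have := (isOpen_orCoord_eq (I := I) x₀ x₁ o o').preimage (continuous_subtype_val
        (p := fun x => x ∈ (trivializationAt (EuclideanSpace ℝ (Fin m)) (TangentSpace I) x₁).baseSet))
      convert this using 1
      ext x
      constructor
      · rintro ⟨h, hh⟩
        exact ⟨h, x.2, hh⟩
      · rintro ⟨h, _, hh⟩
        exact ⟨h, hh⟩
    · ext q
      constructor
      · rintro ⟨h, hh⟩
        exact hh
      · intro h
        exact ⟨q.2, h⟩
  · refine Continuous.subtype_mk ?_ _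
    rw [continuous_prod_of_discrete_right]
    intro o
    exact continuous_orSection x₀ o

variable (I M)

/-- The orientation double cover `or_M → M`. -/
def orientationCover : DoubleCover M where
  total := OrPoint I M
  proj := OrPoint.pt
  isCovering := OrPoint.isCoveringMap_pt
  surjective x := by
    obtain ⟨v, hv⟩ : ∃ o : Orientation ℝ (EuclideanSpace ℝ (Fin m)) (Fin m), True :=
      ⟨(PiLp.basisFun 2 ℝ (Fin m)).orientation, trivial⟩
    exact ⟨orSection I x v ⟨x, FiberBundle.mem_baseSet_trivializationAt' x⟩, rfl⟩
  swap q := ⟨q.pt, -q.ori⟩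
  continuous_swap := OrPoint.continuous_swap
  swap_ne q h := by
    obtain ⟨x, o⟩ := q
    simp only [OrPoint.mk.injEq, true_and] at h
    exact Module.Ray.ne_neg_self o h.symm
  proj_eq_iff q q' := by
    obtain ⟨x, o⟩ := q
    obtain ⟨x', o'⟩ := q'
    constructor
    · rintro (rfl : x = x')
      have hor : o' = o ∨ o' = -o := orientation_eq_or_eq_neg o' o
      rcases hor with h | h
      · exact Or.inl (by rw [h])
      · exact Or.inr (by rw [h])
    · rintro (h | h)
      · exact (congrArg OrPoint.pt h).symm
      · exact (congrArg OrPoint.pt h).symm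

end OrientationCover

section TwistedChains

/-- Singular `n`-simplices of a space. -/
abbrev Sing (n : ℕ) (Y : Type u) [TopologicalSpace Y] : Type u := C(stdSimplex ℝ (Fin (n + 1)), Y)

/-- The affine map of standard simplices induced by a map of vertices. -/
def simplexMap {k n : ℕ} (f : Fin (k + 1) → Fin (n + 1)) :
    C(stdSimplex ℝ (Fin (k + 1)), stdSimplex ℝ (Fin (n + 1))) :=
  ⟨stdSimplex.map f, stdSimplex.continuous_map f⟩

/-- The boundary of singular chains with integral coefficients. -/
def singularBoundary (Y : Type u) [TopologicalSpace Y] (n : ℕ) :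
    (Sing (n + 1) Y →₀ ℤ) →ₗ[ℤ] (Sing n Y →₀ ℤ) :=
  Finsupp.linearCombination ℤ fun σ : Sing (n + 1) Y =>
    ∑ i : Fin (n + 2), (-1 : ℤ) ^ (i : ℕ) • Finsupp.single (σ.comp (simplexMap i.succAbove)) (1 : ℤ)

/-- The push-forward of singular chains along a continuous map. -/
def singularMap {Y Z : Type u} [TopologicalSpace Y] [TopologicalSpace Z] (f : C(Y, Z)) (n : ℕ) :
    (Sing n Y →₀ ℤ) →ₗ[ℤ] (Sing n Z →₀ ℤ) :=
  Finsupp.lmapDomain ℤ ℤ fun σ : Sing n Y => f.comp σ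

theorem singularBoundary_comp_singularMap {Y Z : Type u} [TopologicalSpace Y] [TopologicalSpace Z]
    (f : C(Y, Z)) (n : ℕ) :
    singularBoundary Z n ∘ₗ singularMap f (n + 1) = singularMap f n ∘ₗ singularBoundary Y n := by
  ext1 σ
  ext1
  simp [singularBoundary, singularMap, Finsupp.mapDomain_single, ContinuousMap.comp_assoc]

variable {X : Type u} [TopologicalSpace X] (D : DoubleCover X)

/-- The deck involution as a continuous map. -/
def DoubleCover.swapMap : C(D.total, D.total) := ⟨D.swap, D.continuous_swap⟩

/-- The relations `σ̃ + swap ∘ σ̃ = 0`. -/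
def twistRelations (n : ℕ) : Submodule ℤ (Sing n D.total →₀ ℤ) :=
  LinearMap.range (LinearMap.id + singularMap D.swapMap n)

/-- Singular chains of `X` with coefficients in the local system `ℤ_D = D ×_{ℤ₂} ℤ`: they are
generated by the singular simplices `σ` of `X` together with a trivialisation of the double cover
along `σ` (that is, a lift `σ̃` of `σ` to the total space), the two trivialisations of one simplex
being the negatives of each other. -/
abbrev TwistedChain (n : ℕ) : Type u := (Sing n D.total →₀ ℤ) ⧸ twistRelations D n

variable {D} in
/-- The generator of the twisted chains given by a lifted simplex. -/
def simplexChain {n : ℕ} (σ : Sing n D.total) : TwistedChain D n :=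
  (twistRelations D n).mkQ (Finsupp.single σ 1)

/-- The boundary of twisted chains. -/
def twistedBoundary (n : ℕ) : TwistedChain D (n + 1) →ₗ[ℤ] TwistedChain D n :=
  Submodule.mapQ _ _ (singularBoundary D.total n) <| by
    rintro _ ⟨c, rfl⟩
    refine ⟨singularBoundary D.total n c, ?_⟩
    have h := LinearMap.congr_fun (singularBoundary_comp_singularMap D.swapMap n) c
    simp only [LinearMap.comp_apply] at h
    simp only [LinearMap.add_apply, LinearMap.id_apply, map_add, h]

/-- The twisted chains which are supported in a subset `A` of `X`. -/
def supportedIn (n : ℕ) (A : Set X) : Submodule ℤ (TwistedChain D n) :=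
  Submodule.span ℤ {c | ∃ σ : Sing n D.total, (∀ p, D.proj (σ p) ∈ A) ∧ c = simplexChain σ}

/-- Twisted chains whose boundary is supported in `A`, that is, cycles relative to `A`. -/
def IsRelativeCycle (A : Set X) : ∀ {n : ℕ}, TwistedChain D n → Prop
  | 0, _ => True
  | n + 1, c => twistedBoundary D n c ∈ supportedIn D n A

end TwistedChains

section MapsOfDoubleCovers

variable {N X : Type u} [TopologicalSpace N] [TopologicalSpace X]

/-- A morphism `(k; h) : (N, D') → (X, D)` of spaces with double covers over a continuous map
`k : N → X`: an isomorphism `h` between `D'` and `k^* D` of double covers of `N`. -/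
structure DoubleCover.Over (k : C(N, X)) (D' : DoubleCover N) (D : DoubleCover X) where
  iso : D'.total ≃ₜ {q : N × D.total // k q.1 = D.proj q.2}
  iso_proj : ∀ q, (iso q).1.1 = D'.proj q
  iso_swap : ∀ q, (iso (D'.swap q)).1.2 = D.swap (iso q).1.2

variable {k : C(N, X)} {D' : DoubleCover N} {D : DoubleCover X} (h : DoubleCover.Over k D' D)

/-- The map of total spaces underlying a morphism of spaces with double covers. -/
def DoubleCover.Over.lift : C(D'.total, D.total) :=
  ⟨fun q => (h.iso q).1.2,
    (continuous_snd.comp continuous_subtype_val).comp h.iso.continuous⟩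

/-- The push-forward `(k; h)_*` of twisted chains. -/
def twistedMap (n : ℕ) : TwistedChain D' n →ₗ[ℤ] TwistedChain D n :=
  Submodule.mapQ _ _ (singularMap h.lift n) <| by
    have hc : h.lift.comp D'.swapMap = D.swapMap.comp h.lift := by
      ext q
      exact h.iso_swap q
    rintro _ ⟨c, rfl⟩
    refine ⟨singularMap h.lift n c, ?_⟩
    simp only [LinearMap.add_apply, LinearMap.id_apply, map_add, add_right_inj]
    simp only [singularMap, Finsupp.lmapDomain_apply, ← Finsupp.mapDomain_comp]
    congr 1
    funext σ
    simp only [Function.comp_apply, ← ContinuousMap.comp_assoc, hc]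

end MapsOfDoubleCovers

section FundamentalChains

variable {m : ℕ} {H : Type*} [TopologicalSpace H]
  (I : ModelWithCorners ℝ (EuclideanSpace ℝ (Fin m)) H)
  (M : Type u) [TopologicalSpace M] [ChartedSpace H M] [IsManifold I 1 M]

variable {M} in
/-- `σ` is an oriented simplex of dimension `dim M` which represents the canonical generator of
the local homology group `H_m(M, M \ {x}; ℤ_or)`: in the chart at `x` it is the affine simplex with
vertices `v, v + b 0, v + b 1, …`, where `b` is a basis of `ℝ^m`; the point `x` lies in its
interior, and along the simplex the orientation is that of the basis `b`. -/
def IsLocalGenerator (x : M) (σ : Sing m (orientationCover I M).total) : Prop :=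
  ∃ (v : EuclideanSpace ℝ (Fin m)) (b : Module.Basis (Fin m) ℝ (EuclideanSpace ℝ (Fin m)))
    (w : stdSimplex ℝ (Fin (m + 1))),
    (∀ i, 0 < w i) ∧ extChartAt I x x = v + ∑ i, w i.succ • b i ∧
    ∀ p : stdSimplex ℝ (Fin (m + 1)),
      extChartAt I x ((orientationCover I M).proj (σ p)) = v + ∑ i, p i.succ • b i ∧
      ∃ hp, orCoord (I := I) x (σ p) hp = b.orientation

/-- Fundamental chains of a compact manifold `M` of dimension `m`: the `or_M`-twisted singular
`m`-chains `c` which represent the fundamental class in `H_m(M, ∂M; ℤ_or)`. This means that `c` is a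
cycle relative to the boundary and represents the canonical generator of
`H_m(M, M \ {x}; ℤ_or)` for every interior point `x`. -/
def IsFundamentalChain (c : TwistedChain (orientationCover I M) m) : Prop :=
  IsRelativeCycle (orientationCover I M) (I.boundary M) c ∧
  ∀ x : M, I.IsInteriorPoint x → ∃ σ, IsLocalGenerator I x σ ∧
    c - simplexChain σ ∈ LinearMap.range (twistedBoundary (orientationCover I M) m) ⊔
      supportedIn (orientationCover I M) m {x}ᶜ

end FundamentalChains

section Bundles

/-- A principal `G`-bundle on `X`, for a discrete group `G`: a covering of `X` with a right action
of `G` which is free and transitive on each fibre. -/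
structure PrincipalBundle (G : Type) [Group G] (X : Type u) [TopologicalSpace X] where
  total : Type u
  [top : TopologicalSpace total]
  proj : total → X
  isCovering : IsCoveringMap proj
  surjective : Function.Surjective proj
  act : total → G → total
  continuous_act : ∀ g, Continuous fun p => act p g
  act_one : ∀ p, act p 1 = p
  act_mul : ∀ p g g', act p (g * g') = act (act p g) g'
  proj_act : ∀ p g, proj (act p g) = proj p
  existsUnique_act : ∀ p q, proj p = proj q → ∃! g, act p g = q

attribute [instance] PrincipalBundle.top

variable {G : Type} [Group G] {X N : Type u} [TopologicalSpace X] [TopologicalSpace N]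

theorem isCoveringMap_pullback {E : Type u} [TopologicalSpace E] {p : E → X} (hp : IsCoveringMap p)
    (k : C(N, X)) :
    IsCoveringMap fun q : {q : N × E // k q.1 = p q.2} => q.1.1 := by
  intro y
  obtain ⟨hd, U, hU, hUo, hpU, h, hh⟩ := hp (k y)
  have hc : Continuous fun q : {q : N × E // k q.1 = p q.2} => q.1.1 :=
    continuous_fst.comp continuous_subtype_val
  refine IsEvenlyCovered.to_isEvenlyCovered_preimage (I := p ⁻¹' {k y})
    ⟨hd, k ⁻¹' U, hU, hUo.preimage k.continuous, (hUo.preimage k.continuous).preimage hc, ?_⟩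
  have hmem : ∀ q : (fun q : {q : N × E // k q.1 = p q.2} => q.1.1) ⁻¹' (k ⁻¹' U),
      q.1.1.2 ∈ p ⁻¹' U := by
    intro q
    have := q.2
    simp only [Set.mem_preimage] at this ⊢
    rwa [← q.1.2]
  have hsymm : ∀ z : (k ⁻¹' U) × (p ⁻¹' {k y}),
      k z.1 = p (h.symm (⟨k z.1, z.1.2⟩, z.2)) := by
    intro z
    rw [← hh]
    simp
  refine ⟨{ toFun := fun q => (⟨q.1.1.1, q.2⟩, (h ⟨q.1.1.2, hmem q⟩).2)
            invFun := fun z => ⟨⟨(z.1, h.symm (⟨k z.1, z.1.2⟩, z.2)), hsymm z⟩, z.1.2⟩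
            left_inv := ?_
            right_inv := ?_
            continuous_toFun := by fun_prop
            continuous_invFun := ?_ }, fun q => rfl⟩
  · intro q
    refine Subtype.ext (Subtype.ext (Prod.ext rfl ?_))
    have h1 : ((⟨k q.1.1.1, q.2⟩ : U), (h ⟨q.1.1.2, hmem q⟩).2) = h ⟨q.1.1.2, hmem q⟩ := by
      refine Prod.ext (Subtype.ext ?_) rfl
      rw [hh]
      exact q.1.2
    change (h.symm ((⟨k q.1.1.1, q.2⟩ : U), (h ⟨q.1.1.2, hmem q⟩).2) : E) = q.1.1.2
    rw [h1, Homeomorph.symm_apply_apply]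
  · intro z
    refine Prod.ext rfl ?_
    change (h (h.symm (⟨k z.1, z.1.2⟩, z.2))).2 = z.2
    rw [Homeomorph.apply_symm_apply]
  · fun_prop

/-- The pull-back `k^* P` of a principal bundle. -/
def PrincipalBundle.pullback (P : PrincipalBundle G X) (k : C(N, X)) : PrincipalBundle G N where
  total := {q : N × P.total // k q.1 = P.proj q.2}
  proj q := q.1.1
  isCovering := isCoveringMap_pullback P.isCovering k
  surjective y := by
    obtain ⟨p, hp⟩ := P.surjective (k y)
    exact ⟨⟨(y, p), hp.symm⟩, rfl⟩
  act q g := ⟨(q.1.1, P.act q.1.2 g), by rw [P.proj_act]; exact q.2⟩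
  continuous_act g := by
    have := P.continuous_act g
    fun_prop
  act_one q := Subtype.ext (Prod.ext rfl (P.act_one _))
  act_mul q g g' := Subtype.ext (Prod.ext rfl (P.act_mul _ _ _))
  proj_act q g := rfl
  existsUnique_act q q' hq := by
    have hq : q.1.1 = q'.1.1 := hq
    obtain ⟨g, hg, hu⟩ := P.existsUnique_act q.1.2 q'.1.2 (by rw [← q.2, ← q'.2, hq])
    refine ⟨g, Subtype.ext (Prod.ext hq hg), fun g' hg' => hu g' ?_⟩
    exact congrArg (fun q : {q : N × P.total // k q.1 = P.proj q.2} => q.1.2) hg'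

variable (π : G →* ℤˣ)

/-- The relation `(p g, s) ∼ (p, π(g) s)` on `P × ℤ₂`. -/
def indSetoid (P : PrincipalBundle G X) : Setoid (P.total × ℤˣ) where
  r a b := ∃ g, b.1 = P.act a.1 g ∧ a.2 = π g * b.2
  iseqv :=
    { refl := fun a => ⟨1, (P.act_one _).symm, by simp⟩
      symm := by
        rintro a b ⟨g, h1, h2⟩
        refine ⟨g⁻¹, ?_, ?_⟩
        · rw [h1, ← P.act_mul, mul_inv_cancel, P.act_one]
        · rw [h2, map_inv, inv_mul_cancel_left]
      trans := by
        rintro a b c ⟨g, h1, h2⟩ ⟨g', h3, h4⟩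
        refine ⟨g * g', ?_, ?_⟩
        · rw [h3, h1, P.act_mul]
        · rw [h2, h4, map_mul, mul_assoc] }

/-- The double cover `Ind_π(P) = P ×_G ℤ₂` induced by a principal bundle, with the quotient
topology. -/
abbrev Ind (P : PrincipalBundle G X) : Type u := Quotient (indSetoid π P)

/-- The class `[p, s]` in `P ×_G ℤ₂`. -/
def Ind.mk (P : PrincipalBundle G X) (p : P.total) (s : ℤˣ) : Ind π P :=
  Quotient.mk (indSetoid π P) (p, s)

variable {π} in
theorem Ind.mk_act (P : PrincipalBundle G X) (p : P.total) (g : G) (s : ℤˣ) :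
    Ind.mk π P (P.act p g) s = Ind.mk π P p (π g * s) :=
  (Quotient.sound (s := indSetoid π P) ⟨g, rfl, rfl⟩).symm

/-- Objects of the groupoid `Bun^D_G(X)` for a double cover `D` of `X`: pairs `(P, ε)` of a principal
`G`-bundle `P` on `X` and an isomorphism `ε : P ×_G ℤ₂ ≃ D` of double covers of `X`. For
`D = or_X` this is the groupoid of orientation twisted bundles. -/
structure TwistedBundle (D : DoubleCover X) where
  bundle : PrincipalBundle G X
  framing : Ind π bundle ≃ₜ D.total
  proj_framing : ∀ p s, D.proj (framing (Ind.mk π bundle p s)) = bundle.proj p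
  framing_neg : ∀ p s, framing (Ind.mk π bundle p (-s)) = D.swap (framing (Ind.mk π bundle p s))

variable {π} in
/-- Morphisms `(P, ε) → (P', ε')`: morphisms `f : P → P'` of principal bundles such that
`ε' ∘ Ind_π(f) = ε`. -/
@[ext]
structure TwistedBundle.Hom {D : DoubleCover X} (P Q : TwistedBundle π D) where
  map : C(P.bundle.total, Q.bundle.total)
  proj_map : ∀ p, Q.bundle.proj (map p) = P.bundle.proj p
  map_act : ∀ p g, map (P.bundle.act p g) = Q.bundle.act (map p) g
  framing_map : ∀ p s, Q.framing (Ind.mk π Q.bundle (map p) s) = P.framing (Ind.mk π P.bundle p s)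

instance (D : DoubleCover X) : CategoryTheory.Category.{u} (TwistedBundle π D) where
  Hom P Q := TwistedBundle.Hom P Q
  id P := ⟨ContinuousMap.id _, fun _ => rfl, fun _ _ => rfl, fun _ _ => rfl⟩
  comp f f' := ⟨f'.map.comp f.map, fun p => (f'.proj_map _).trans (f.proj_map p),
    fun p g => (congrArg f'.map (f.map_act p g)).trans (f'.map_act _ g),
    fun p s => (f'.framing_map _ s).trans (f.framing_map p s)⟩

theorem isOpenMap_indMk (P : PrincipalBundle G X) :
    IsOpenMap (Quotient.mk (indSetoid π P)) := by
  intro U hU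
  change IsOpen (Quotient.mk (indSetoid π P) ⁻¹' (Quotient.mk (indSetoid π P) '' U))
  have : Quotient.mk (indSetoid π P) ⁻¹' (Quotient.mk (indSetoid π P) '' U)
      = ⋃ g : G, (fun a : P.total × ℤˣ => (P.act a.1 g, (π g)⁻¹ * a.2)) ⁻¹' U := by
    ext a
    simp only [Set.mem_preimage, Set.mem_image, Set.mem_iUnion]
    constructor
    · rintro ⟨b, hb, hab⟩
      obtain ⟨g, h1, h2⟩ := (indSetoid π P).symm (Quotient.exact hab)
      refine ⟨g, ?_⟩
      rw [h2, inv_mul_cancel_left, ← h1]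
      exact hb
    · rintro ⟨g, hg⟩
      refine ⟨_, hg, ?_⟩
      exact (Quotient.sound (s := indSetoid π P) ⟨g, rfl, (mul_inv_cancel_left _ _).symm⟩).symm
  rw [this]
  refine isOpen_iUnion fun g => hU.preimage ?_
  have := P.continuous_act g
  fun_prop

variable {π} in
/-- The isomorphism `(k; h)^* ε : Ind_π(k^* P) ≃ k^* Ind_π(P) ≃ k^* D ≃ D'`, as a map. -/
def restrictFraming {k : C(N, X)} {D' : DoubleCover N} {D : DoubleCover X}
    (h : DoubleCover.Over k D' D) (P : TwistedBundle π D) :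
    Ind π (P.bundle.pullback k) → D'.total :=
  Quotient.lift (s := indSetoid π (P.bundle.pullback k))
    (fun a => h.iso.symm ⟨(a.1.1.1, P.framing (Ind.mk π P.bundle a.1.1.2 a.2)), by
      rw [P.proj_framing]; exact a.1.2⟩) <| by
    rintro a b ⟨g, h1, h2⟩
    congr 1
    refine Subtype.ext (Prod.ext ?_ ?_)
    · rw [h1]; rfl
    · change P.framing _ = P.framing _
      rw [h1, h2]
      exact congrArg P.framing (Ind.mk_act P.bundle a.1.1.2 g b.2).symm

theorem restrictFraming_bijective {k : C(N, X)} {D' : DoubleCover N} {D : DoubleCover X}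
    (h : DoubleCover.Over k D' D) (P : TwistedBundle π D) :
    Function.Bijective (restrictFraming h P) := by
  constructor
  · intro a b
    induction a using Quotient.inductionOn
    induction b using Quotient.inductionOn
    rename_i a b
    intro hab
    have hab := h.iso.symm.injective hab
    have h1 : a.1.1.1 = b.1.1.1 := congrArg (fun q => q.1.1) hab
    have h2 : Ind.mk π P.bundle a.1.1.2 a.2 = Ind.mk π P.bundle b.1.1.2 b.2 :=
      P.framing.injective (congrArg (fun q => q.1.2) hab)
    obtain ⟨g, h3, h4⟩ := Quotient.exact h2
    exact Quotient.sound (s := indSetoid π (P.bundle.pullback k))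
      ⟨g, Subtype.ext (Prod.ext h1.symm h3), h4⟩
  · intro q
    obtain ⟨⟨p, s⟩, hps⟩ := Quotient.exists_rep (P.framing.symm (h.iso q).1.2)
    have hps : P.framing (Ind.mk π P.bundle p s) = (h.iso q).1.2 := by
      rw [← P.framing.apply_symm_apply (h.iso q).1.2, ← hps]
      rfl
    have hp : k (h.iso q).1.1 = P.bundle.proj p := by
      rw [(h.iso q).2, ← hps, P.proj_framing]
    refine ⟨Ind.mk π (P.bundle.pullback k) ⟨((h.iso q).1.1, p), hp⟩ s, ?_⟩
    apply h.iso.injective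
    refine (h.iso.apply_symm_apply _).trans ?_
    exact Subtype.ext (Prod.ext rfl hps)

theorem continuous_restrictFraming {k : C(N, X)} {D' : DoubleCover N} {D : DoubleCover X}
    (h : DoubleCover.Over k D' D) (P : TwistedBundle π D) :
    Continuous (restrictFraming h P) := by
  refine Continuous.quotient_lift (s := indSetoid π (P.bundle.pullback k)) ?_ _
  refine h.iso.symm.continuous.comp (Continuous.subtype_mk (Continuous.prodMk ?_ ?_) _)
  · exact continuous_fst.comp (continuous_subtype_val.comp continuous_fst)
  · refine P.framing.continuous.comp ((continuous_quotient_mk' (s := indSetoid π P.bundle)).comp ?_)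
    exact (continuous_snd.comp (continuous_subtype_val.comp continuous_fst)).prodMk continuous_snd

theorem isOpenMap_restrictFraming {k : C(N, X)} {D' : DoubleCover N} {D : DoubleCover X}
    (h : DoubleCover.Over k D' D) (P : TwistedBundle π D) :
    IsOpenMap (restrictFraming h P) := by
  let T := (P.bundle.pullback k).total × ℤˣ
  let f : T → {q : N × D.total // k q.1 = D.proj q.2} := fun a =>
    ⟨(a.1.1.1, P.framing (Ind.mk π P.bundle a.1.1.2 a.2)), by rw [P.proj_framing]; exact a.1.2⟩
  have hf : IsOpenMap f := by
    rw [isOpenMap_iff_nhds_le]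
    rintro ⟨⟨⟨y, p⟩, hyp⟩, s⟩ W hW
    have hW : (fun q : {q : N × P.bundle.total // k q.1 = P.bundle.proj q.2} =>
        f (q, s)) ⁻¹' W ∈ 𝓝 ⟨(y, p), hyp⟩ :=
      (Continuous.prodMk_left (X := {q : N × P.bundle.total // k q.1 = P.bundle.proj q.2})
        s).continuousAt.preimage_mem_nhds hW
    rw [nhds_subtype_eq_comap, Filter.mem_comap] at hW
    obtain ⟨S, hS, hSW⟩ := hW
    rw [nhds_prod_eq, Filter.mem_prod_iff] at hS
    obtain ⟨V, hV, U, hU, hVU⟩ := hS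
    have hO : P.framing '' (Quotient.mk (indSetoid π P.bundle) '' (U ×ˢ {s})) ∈
        𝓝 (P.framing (Ind.mk π P.bundle p s)) := by
      refine P.framing.isOpenMap.image_mem_nhds ((isOpenMap_indMk π P.bundle).image_mem_nhds ?_)
      exact prod_mem_nhds hU (by simp)
    rw [nhds_subtype_eq_comap, Filter.mem_comap]
    refine ⟨V ×ˢ (P.framing '' (Quotient.mk (indSetoid π P.bundle) '' (U ×ˢ {s}))),
      prod_mem_nhds hV hO, ?_⟩
    rintro ⟨⟨y', d⟩, hd⟩ ⟨hy', ⟨_, ⟨⟨p', s'⟩, ⟨hp', hs'⟩, rfl⟩, hd'⟩⟩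
    obtain rfl : s' = s := hs'
    have hd'' : P.framing (Ind.mk π P.bundle p' s') = d := hd'
    have hp2 : k y' = P.bundle.proj p' := by
      have : k y' = D.proj d := hd
      rw [this, ← hd'', P.proj_framing]
    have := @hSW ⟨(y', p'), hp2⟩ (hVU ⟨hy', hp'⟩)
    have h3 : f (⟨(y', p'), hp2⟩, s') = ⟨(y', d), hd⟩ := Subtype.ext (Prod.ext rfl hd'')
    rw [← h3]
    exact this
  intro U hU
  have h1 : restrictFraming h P '' U
      = (h.iso.symm ∘ f) '' (Quotient.mk (indSetoid π (P.bundle.pullback k)) ⁻¹' U) := by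
    ext q
    constructor
    · rintro ⟨a, ha, rfl⟩
      induction a using Quotient.inductionOn
      rename_i a
      exact ⟨a, ha, rfl⟩
    · rintro ⟨a, ha, rfl⟩
      exact ⟨_, ha, rfl⟩
  rw [h1]
  exact (h.iso.symm.isOpenMap.comp hf) _ (hU.preimage continuous_quotient_mk')

variable {π} in
/-- The restriction `(k; h)^* (P, ε)` of a twisted bundle. -/
def TwistedBundle.restrict {k : C(N, X)} {D' : DoubleCover N} {D : DoubleCover X}
    (h : DoubleCover.Over k D' D) (P : TwistedBundle π D) : TwistedBundle π D' where
  bundle := P.bundle.pullback k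
  framing := (Equiv.ofBijective _ (restrictFraming_bijective π h P)).toHomeomorphOfContinuousOpen
    (continuous_restrictFraming π h P) (isOpenMap_restrictFraming π h P)
  proj_framing p s := by
    change D'.proj (h.iso.symm _) = p.1.1
    rw [← h.iso_proj, Homeomorph.apply_symm_apply]
  framing_neg p s := by
    change h.iso.symm _ = D'.swap (h.iso.symm _)
    apply h.iso.injective
    rw [Homeomorph.apply_symm_apply]
    refine Subtype.ext (Prod.ext ?_ ?_)
    · rw [h.iso_proj, D'.proj_swap, ← h.iso_proj, Homeomorph.apply_symm_apply]
    · rw [h.iso_swap, Homeomorph.apply_symm_apply]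
      exact P.framing_neg _ _

/-- The restriction functor `(k; h)^* : Bun^D_G(X) ⥤ Bun^D'_G(N)`. -/
def restrictFunctor {k : C(N, X)} {D' : DoubleCover N} {D : DoubleCover X}
    (h : DoubleCover.Over k D' D) :
    CategoryTheory.Functor (TwistedBundle π D) (TwistedBundle π D') where
  obj P := P.restrict h
  map {P Q} f :=
    { map := ⟨fun q => ⟨(q.1.1, f.map q.1.2), by rw [f.proj_map]; exact q.2⟩, by
        have := f.map.continuous
        fun_prop⟩
      proj_map := fun _ => rfl
      map_act := fun q g => Subtype.ext (Prod.ext rfl (f.map_act q.1.2 g))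
      framing_map := fun q s => by
        change h.iso.symm _ = h.iso.symm _
        congr 1
        exact Subtype.ext (Prod.ext rfl (f.framing_map q.1.2 s)) }
  map_id _ := rfl
  map_comp _ _ := rfl

end Bundles

section Cochains

variable {G : Type} [Group G] (π : G →* ℤˣ) (A : Type) [AddCommGroup A]

/-- The `G`-module `A_π`: the abelian group `A`, on which `g` acts by the sign `π(g)`. For
`A = ℂ^×`, written additively, this is `ℂ^×_π`, where `g` acts by `z ↦ z ^ π(g)`. -/
def twistedCoeff : Rep ℤ G :=
  Rep.of (X := A)
    { toFun := fun g => ((π g : ℤˣ) : ℤ) • LinearMap.id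
      map_one' := by simp; rfl
      map_mul' := fun g g' => by
        apply LinearMap.ext
        intro z
        simp [mul_smul] }

/-- Twisted `n`-cochains `C^n(BG; A_π)` on the classifying groupoid `BG`: functions on the
`n`-simplices `(g₁, …, gₙ)` of its nerve. -/
abbrev GroupCochain (G A : Type) (n : ℕ) : Type := (Fin n → G) → A

variable {A} in
/-- Twisted cocycles `Z^n(BG; A_π)`. -/
def IsTwistedCocycle {n : ℕ} (lam : GroupCochain G A n) : Prop :=
  inhomogeneousCochains.d (twistedCoeff π A) n lam = 0

open CategoryTheory in
/-- `n`-cochains `C^n(B; A)` on a groupoid `B`: functions on the `n`-simplices of its nerve. -/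
abbrev Cochain (A : Type) (B : Type*) [Category B] (n : ℕ) : Type _ := ComposableArrows B n → A

open CategoryTheory in
/-- Pull-back of a simplex `P₀ → ⋯ → Pₖ` of the nerve along a monotone map of vertices. -/
def nerveComp {B : Type*} [Category B] {n k : ℕ} (f : Fin (n + 1) → Fin (k + 1)) (hf : Monotone f)
    (α : ComposableArrows B k) : ComposableArrows B n :=
  hf.functor ⋙ α

variable {A}

open CategoryTheory in
/-- The coboundary, with the sign convention `(δ φ)(Δ) = (-1)^(k+1) φ(∂ Δ)` for a `k`-cochain
`φ`. -/
def coboundary {B : Type*} [Category B] {k : ℕ} (φ : Cochain A B k) : Cochain A B (k + 1) := fun α =>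
  (-1 : ℤ) ^ (k + 1) • ∑ i : Fin (k + 2),
    (-1 : ℤ) ^ (i : ℕ) • φ (nerveComp i.succAbove (Fin.strictMono_succAbove i).monotone α)

open CategoryTheory in
/-- Pull-back of cochains along a functor. -/
def Cochain.pullback {B B' : Type*} [Category B] [Category B'] (F : B ⥤ B') {k : ℕ}
    (φ : Cochain A B' k) : Cochain A B k :=
  fun α => φ (α ⋙ F)

variable {X : Type u} [TopologicalSpace X]

open CategoryTheory in
/-- `n`-cochains `C^n(B × X; A_D)` on the product of a groupoid `B` with a space `X`, with
coefficients twisted by the pull-back of a double cover `D` of `X`: functions of an `n`-simplex of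
the nerve of `B`, an `n`-simplex of `X` and a trivialisation of `D` along the latter (together, a
simplex of the total space of `D`), which change sign with the trivialisation. -/
def ProductCochain (A : Type) [AddCommGroup A] (B : Type*) [Category B] (D : DoubleCover X) (n : ℕ) : Type _ :=
  {F : ComposableArrows B n → Sing n D.total → A // ∀ α σ, F α (D.swapMap.comp σ) = -F α σ}

/-- The covering projection as a continuous map. -/
def DoubleCover.projMap (D : DoubleCover X) : C(D.total, X) := ⟨D.proj, D.isCovering.continuous⟩

end Cochains

section Evaluation

variable {G : Type} [Group G] {π : G →* ℤˣ} {A : Type} [AddCommGroup A] {X : Type u} [TopologicalSpace X]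

theorem exists_lift_simplex (P : PrincipalBundle G X) {n : ℕ} (σ : Sing n X) :
    ∃ l : Sing n P.total, ∀ p, P.proj (l p) = σ p := by
  have hne : (stdSimplex ℝ (Fin (n + 1))).Nonempty := ⟨_, single_mem_stdSimplex ℝ (0 : Fin (n + 1))⟩
  have : ContractibleSpace (stdSimplex ℝ (Fin (n + 1))) :=
    (convex_stdSimplex ℝ (Fin (n + 1))).contractibleSpace hne
  have : LocallyPathConnectedSpace (stdSimplex ℝ (Fin (n + 1))) :=
    (convex_stdSimplex ℝ (Fin (n + 1))).locallyPathConnectedSpace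
  obtain ⟨e, he⟩ := P.surjective (σ (stdSimplex.vertex 0))
  obtain ⟨l, ⟨-, hl⟩, -⟩ := P.isCovering.existsUnique_continuousMap_lifts σ _ e he
  exact ⟨l, fun p => congrFun hl p⟩

/-- A flat section of a principal bundle along a singular simplex. -/
def flatSection (P : PrincipalBundle G X) {n : ℕ} (σ : Sing n X) : Sing n P.total :=
  (exists_lift_simplex P σ).choose

theorem proj_flatSection (P : PrincipalBundle G X) {n : ℕ} (σ : Sing n X) (p) :
    P.proj (flatSection P σ p) = σ p :=
  (exists_lift_simplex P σ).choose_spec p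

variable (π) in
/-- A choice of a point in every fibre of every twisted bundle on `X`. The map
`ev : Bun × X → BG` sends `((P, ε), x)` to the `G`-torsor `P_x`; such a choice is what is needed in
order to pass from `G`-torsors to the one-object groupoid `BG`. -/
abbrev FibrePoints (D : DoubleCover X) : Type (u + 1) :=
  ∀ (P : TwistedBundle π D) (x : X), {p : P.bundle.total // P.bundle.proj p = x}

/-- Choices of points in the fibres of the twisted bundles on `X` and on `N` are compatible with
`(k; h)^*` if the chosen point of `k^* P` over `y` is the chosen point of `P` over `k y`. -/
def FibrePoints.Compatible {N : Type u} [TopologicalSpace N] {k : C(N, X)} {D' : DoubleCover N}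
    {D : DoubleCover X} (h : DoubleCover.Over k D' D) (t : FibrePoints π D) (s : FibrePoints π D') :
    Prop :=
  ∀ (P : TwistedBundle π D) (y : N),
    ((s (P.restrict h) y).1 : {q : N × P.bundle.total // k q.1 = P.bundle.proj q.2}).1.2
      = (t P (k y)).1

variable {D : DoubleCover X} (t : FibrePoints π D) {n : ℕ}

open CategoryTheory

/-- The chosen point at the `k`-th vertex of a simplex `(P₀ → ⋯ → Pₙ, σ)` of `Bun × X`, compared with
the parallel transport of a flat section: it is `f_k(l(v_k)) · a`, where `f_k : P₀ → P_k` and `l` is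
the flat section of `P₀` along `σ`, and this is `a`. -/
def vertexFrame (α : ComposableArrows (TwistedBundle π D) n) (σ : Sing n X) (k : Fin (n + 1)) : G :=
  ((α.obj k).bundle.existsUnique_act
    (TwistedBundle.Hom.map (α.map (homOfLE (Fin.zero_le k)))
      (flatSection (α.obj 0).bundle σ (stdSimplex.vertex k)))
    (t (α.obj k) (σ (stdSimplex.vertex k)))
    (by rw [TwistedBundle.Hom.proj_map, proj_flatSection, (t _ _).2])).choose

/-- The image `(g₁, …, gₙ)` under `ev : Bun × X → BG` of a simplex `(P₀ → ⋯ → Pₙ, σ)` of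
`Bun × X`: parallel transport from the `i`-th to the `(i+1)`-st vertex sends `t_i · g_{i+1}` to
`t_{i+1}`, where `t_i` is the chosen point of the fibre of `P_i` at `σ(v_i)`. -/
def evSimplex (α : ComposableArrows (TwistedBundle π D) n) (σ : Sing n X) : Fin n → G := fun i =>
  (vertexFrame t α σ i.castSucc)⁻¹ * vertexFrame t α σ i.succ

open Classical in
/-- The sign comparing the trivialisation `[t₀, 1]` of `Ind_π(P₀)` at the initial vertex, carried to
`D` by the framing of `P₀`, with the trivialisation of `D` given by `σ`. -/
def evSign (α : ComposableArrows (TwistedBundle π D) n) (σ : Sing n D.total) : ℤ :=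
  if (α.obj 0).framing (Ind.mk π (α.obj 0).bundle
      (t (α.obj 0) (D.proj (σ (stdSimplex.vertex 0)))) 1) = σ (stdSimplex.vertex 0) then 1 else -1

open Classical in
theorem evSign_swap (α : ComposableArrows (TwistedBundle π D) n) (σ : Sing n D.total) :
    evSign t α (D.swapMap.comp σ) = -evSign t α σ := by
  unfold evSign
  change (if (α.obj 0).framing (Ind.mk π (α.obj 0).bundle
      (t (α.obj 0) (D.proj (D.swap (σ (stdSimplex.vertex 0))))) 1) = D.swap (σ (stdSimplex.vertex 0))
      then (1 : ℤ) else -1) = _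
  rw [D.proj_swap]
  have h1 : D.proj ((α.obj 0).framing (Ind.mk π (α.obj 0).bundle
      (t (α.obj 0) (D.proj (σ (stdSimplex.vertex 0)))) 1)) = D.proj (σ (stdSimplex.vertex 0)) := by
    rw [TwistedBundle.proj_framing, (t _ _).2]
  rcases (D.proj_eq_iff _ _).1 h1.symm with h | h
  · rw [if_pos h, h, if_neg (fun h' => D.swap_ne _ h'.symm)]
  · rw [h, if_pos rfl, if_neg (D.swap_ne _), neg_neg]

/-- The map `ev^* : C^n(BG; A_π) → C^n(Bun × X; A_D)`: pull-back along `ev`, followed by the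
isomorphism of twisted cochains given by the framings. -/
def evPullback (lam : GroupCochain G A n) : ProductCochain A (TwistedBundle π D) D n :=
  ⟨fun α σ => evSign t α σ • lam (evSimplex t α (D.projMap.comp σ)), by
    intro α σ
    have h : D.projMap.comp (D.swapMap.comp σ) = D.projMap.comp σ := by
      ext p
      exact D.proj_swap _
    change evSign t α (D.swapMap.comp σ) • lam (evSimplex t α (D.projMap.comp (D.swapMap.comp σ)))
      = -(evSign t α σ • lam (evSimplex t α (D.projMap.comp σ)))
    rw [evSign_swap, h, neg_smul]⟩

end Evaluation

section Transgression

open CategoryTheory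

/-- The `(d, m)`-shuffles: the maximal chains `(0,0) < ⋯ < (d,m)` in `[d] × [m]`, when
`n = d + m`. They index the top-dimensional simplices of `Δ^d × Δ^m`. -/
abbrev Shuffle (d m n : ℕ) : Type := {φ : Fin (n + 1) → Fin (d + 1) × Fin (m + 1) // StrictMono φ}

instance (d m n : ℕ) : Fintype (Shuffle d m n) := Fintype.ofFinite _

/-- The sign of a shuffle: the parity of the number of pairs of a step in the second direction
followed by a later step in the first direction. -/
def Shuffle.sign {d m n : ℕ} (φ : Shuffle d m n) : ℤ :=
  (-1) ^ ∑ i : Fin n, (((φ.1 i.succ).1 : ℕ) - ((φ.1 i.castSucc).1 : ℕ)) * ((φ.1 i.castSucc).2 : ℕ)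

theorem Shuffle.monotone_fst {d m n : ℕ} (φ : Shuffle d m n) : Monotone fun i => (φ.1 i).1 :=
  fun _ _ h => (φ.2.monotone h).1

variable {A : Type} [AddCommGroup A] {B : Type*} [Category B] {X : Type u} [TopologicalSpace X]
  {D : DoubleCover X}
  {d m n : ℕ}

/-- The value of a cochain of degree `n = d + m` on the (Eilenberg–Zilber) cross product `α × σ` of
a `d`-simplex of the nerve of `B` and a lifted `m`-simplex of `X`. -/
def crossValue (F : ProductCochain A B D n) (α : ComposableArrows B d) (σ : Sing m D.total) : A :=
  ∑ φ : Shuffle d m n, φ.sign •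
    F.1 (nerveComp (fun i => (φ.1 i).1) φ.monotone_fst α)
      (σ.comp (simplexMap fun i => (φ.1 i).2))

/-- Push-forward along the projection `B × X → B`, that is, integration over the chain `c` in the
second factor: the map `C^n(B × X; A_D) → C^d(B; A)`, `n = d + m`, sending `F` to
`α ↦ ⟨F, α × c⟩`. -/
def pushforward (c : TwistedChain D m) (_h : d + m = n) (F : ProductCochain A B D n) : Cochain A B d :=
  fun α => (twistRelations D m).liftQ
    (Finsupp.linearCombination ℤ (crossValue F α)) (by
      rintro _ ⟨b, rfl⟩
      induction b using Finsupp.induction_linear with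
      | zero => simp
      | add x y hx hy => rw [map_add]; exact Submodule.add_mem _ hx hy
      | single σ z =>
        have h : crossValue F α (D.swapMap.comp σ) = -crossValue F α σ := by
          simp only [crossValue, ContinuousMap.comp_assoc, F.2, smul_neg, Finset.sum_neg_distrib]
        simp [singularMap, Finsupp.mapDomain_single, Finsupp.linearCombination_single, h]) c

variable {G : Type} [Group G] {π : G →* ℤˣ}

/-- Orientation twisted transgression along `M` (with `D = or_M` and `c` a fundamental chain of
`M`): the composite of `C^n(BG; A_π) → C^n(Bun × M; A_or)` and the push-forward
`C^n(Bun × M; A_or) → C^(n - m)(Bun; A)`. -/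
def transgression (t : FibrePoints π D) (c : TwistedChain D m) (h : d + m = n)
    (lam : GroupCochain G A n) : Cochain A (TwistedBundle π D) d :=
  pushforward c h (evPullback t lam)

end Transgression

end
end OrTransgression

open OrTransgression

/-! The theorem is Stokes' formula for integration along the fibre `M`, applied to the closed
cochain `ev^* λ` on the product of the bundle groupoid with `M`. Three facts carry it.

Closedness (`sum_evPullback_face`). Compare the chosen fibre points at the vertices of a simplex
with one flat section; this gives frames `a₀, …, aₙ₊₁`, and the edges of the simplex go to `aᵢ⁻¹
aᵢ₊₁`. Every face can be computed with the same frames (`evPullback_nerveComp`), up to a sign `π(a)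
ε` with `a` the frame at the first vertex of the face. Only the face opposite to vertex `0` has
another first vertex, and the quotient of the two signs is `π(a₀⁻¹ a₁)`, the twist in the first term
of the cocycle condition. Hence the alternating sum over the faces is the cocycle condition, up to
sign.

The Leibniz rule (`chainSum_faceSum`). The boundary of the shuffle triangulation of `Δ^D × Δ^M` is
`∂Δ^D × Δ^M + (-1)^D Δ^D × ∂Δ^M`. The proof is by induction on the total dimension, cutting lattice
paths after their first step. Evaluating a closed cochain on both sides gives `dτ(c) = -τ(∂c)`; the
sign in the definition of `coboundary` cancels `(-1)^D` up to a single minus.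

Naturality (`evPullback_restrict`, `transgression_twistedMap`). With compatible fibre points,
integrating over a chain pushed forward from `∂M` is the same as restricting the bundles and
integrating over `∂M`.

Since `∂c_M = j_* c_{∂M}`, the first part follows. On a closed manifold of positive dimension, a
cycle relative to the empty boundary is a cycle, so the right-hand side vanishes. -/

namespace OrTransgression

noncomputable section

/-! ### Lattice paths and the Leibniz rule for the shuffle product -/

section LatticePaths

/-- Strictly increasing chains of length `n + 1` in `[D] × [M]`, where `[D]` has `D` elements. -/
abbrev Chain (D M n : ℕ) : Type := {φ : Fin (n + 1) → Fin D × Fin M // StrictMono φ}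

instance (D M n : ℕ) : Fintype (Chain D M n) := Fintype.ofFinite _

/-- Counting vertices instead of dimensions lets the faces of `Δ^0` be indexed by the empty type.
Their contributions then vanish by themselves, so one Leibniz rule also covers dimension zero in
either factor. -/
instance (M n : ℕ) : IsEmpty (Chain 0 M n) := ⟨fun φ => (φ.1 0).1.elim0⟩

instance (D n : ℕ) : IsEmpty (Chain D 0 n) := ⟨fun φ => (φ.1 0).2.elim0⟩

/-- The sign of a chain, given by the same formula as that of a shuffle. -/
def Chain.sign {D M n : ℕ} (φ : Chain D M n) : ℤ :=
  (-1) ^ ∑ i : Fin n, (((φ.1 i.succ).1 : ℕ) - ((φ.1 i.castSucc).1 : ℕ)) * ((φ.1 i.castSucc).2 : ℕ)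

/-- Each step raises the sum of the coordinates by at least one. With the dual bound
`Chain.rank_le`, this makes a chain of maximal length run from corner to corner. -/
theorem Chain.le_rank {D M n : ℕ} (φ : Chain D M n) (k : Fin (n + 1)) :
    (k : ℕ) ≤ ((φ.1 k).1 : ℕ) + ((φ.1 k).2 : ℕ) := by
  induction k using Fin.induction with
  | zero => simp
  | succ k ih =>
    have h := φ.2 (Fin.castSucc_lt_succ (i := k))
    rw [Prod.lt_iff] at h
    simp only [Fin.lt_def, Fin.le_def, Fin.val_succ, Fin.val_castSucc] at *
    omega

theorem Chain.rank_le {D M n : ℕ} (φ : Chain (D + 1) (M + 1) n) (k : Fin (n + 1)) :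
    ((φ.1 k).1 : ℕ) + ((φ.1 k).2 : ℕ) + n ≤ D + M + k := by
  induction k using Fin.reverseInduction with
  | last =>
    have := (φ.1 (Fin.last n)).1.2
    have := (φ.1 (Fin.last n)).2.2
    simp only [Fin.val_last]
    omega
  | cast k ih =>
    have h := φ.2 (Fin.castSucc_lt_succ (i := k))
    rw [Prod.lt_iff] at h
    simp only [Fin.lt_def, Fin.le_def, Fin.val_succ, Fin.val_castSucc] at *
    omega

theorem Chain.apply_zero {D M n : ℕ} (h : D + M = n) (φ : Chain (D + 1) (M + 1) n) : φ.1 0 = 0 := by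
  have := φ.rank_le 0
  simp only [Fin.val_zero] at this
  refine Prod.ext (Fin.ext ?_) (Fin.ext ?_) <;>
    simp only [Prod.fst_zero, Prod.snd_zero, Fin.val_zero] <;> omega

theorem Chain.apply_last_fst {D M n : ℕ} (h : D + M = n) (φ : Chain (D + 1) (M + 1) n) :
    ((φ.1 (Fin.last n)).1 : ℕ) = D := by
  have := φ.le_rank (Fin.last n)
  have := (φ.1 (Fin.last n)).1.2
  have := (φ.1 (Fin.last n)).2.2
  simp only [Fin.val_last] at *
  omega

theorem strictMono_cons_zero {D M n : ℕ} {χ : Fin (n + 1) → Fin (D + 1) × Fin (M + 1)}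
    (hχ : StrictMono χ) (h : χ 0 ≠ 0) :
    StrictMono (Fin.cons 0 χ : Fin (n + 2) → Fin (D + 1) × Fin (M + 1)) := by
  rw [Fin.strictMono_iff_lt_succ]
  intro i
  induction i using Fin.cases with
  | zero => simpa using lt_of_le_of_ne (by exact ⟨Fin.zero_le _, Fin.zero_le _⟩) h.symm
  | succ i =>
    rw [Fin.castSucc_succ, Fin.cons_succ, Fin.cons_succ]
    exact hχ (Fin.castSucc_lt_succ (i := i))

/-- The chain in `[D + 1] × [M + 1]` starting with `(0, 0)` followed by a horizontal translate. -/
def Chain.consFst {D M n : ℕ} (ψ : Chain D (M + 1) n) : Chain (D + 1) (M + 1) (n + 1) :=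
  ⟨Fin.cons 0 (Prod.map (Fin.succAbove 0) id ∘ ψ.1), by
    refine strictMono_cons_zero ?_ ?_
    · exact ((Fin.strictMono_succAbove 0).prodMap strictMono_id).comp ψ.2
    · exact fun h => Fin.succAbove_ne 0 _ (congrArg Prod.fst h)⟩

/-- The chain in `[D + 1] × [M + 1]` starting with `(0, 0)` followed by a vertical translate. -/
def Chain.consSnd {D M n : ℕ} (ψ : Chain (D + 1) M n) : Chain (D + 1) (M + 1) (n + 1) :=
  ⟨Fin.cons 0 (Prod.map id (Fin.succAbove 0) ∘ ψ.1), by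
    refine strictMono_cons_zero ?_ ?_
    · exact (strictMono_id.prodMap (Fin.strictMono_succAbove 0)).comp ψ.2
    · exact fun h => Fin.succAbove_ne 0 _ (congrArg Prod.snd h)⟩

/-- Monotonicity makes the truncated subtraction harmless, so the sum telescopes. It serves to count
the horizontal steps of a path. -/
theorem sum_sub_of_monotone {n : ℕ} {f : Fin (n + 1) → ℕ} (hf : Monotone f) :
    ∑ i : Fin n, (f i.succ - f i.castSucc) = f (Fin.last n) - f 0 := by
  induction n with
  | zero => simp
  | succ n ih =>
    have h := ih (hf.comp Fin.strictMono_castSucc.monotone)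
    simp only [Function.comp_apply] at h
    rw [Fin.sum_univ_castSucc]
    simp only [Fin.succ_castSucc, h, Fin.succ_last, Fin.castSucc_zero]
    have h1 := hf (Fin.castSucc_lt_succ (i := Fin.last n)).le
    have h2 := hf (Fin.zero_le (Fin.last n).castSucc)
    simp only [Fin.succ_last, Nat.succ_eq_add_one] at h1 h2 ⊢
    omega

/-- The new step starts at height `0` and contributes nothing, while a horizontal translation
changes neither the horizontal differences nor the heights. -/
theorem Chain.sign_consFst {D M n : ℕ} (ψ : Chain D (M + 1) n) : ψ.consFst.sign = ψ.sign := by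
  simp [Chain.sign, Chain.consFst, Fin.sum_univ_succ]

/-- The initial vertical step lies before all horizontal steps. A maximal path has `D` of these, and
each contributes one more inversion. -/
theorem Chain.sign_consSnd {D M n : ℕ} (h : D + M = n) (ψ : Chain (D + 1) (M + 1) n) :
    ψ.consSnd.sign = (-1) ^ D * ψ.sign := by
  have h1 := sum_sub_of_monotone (f := fun k => ((ψ.1 k).1 : ℕ))
    (fun a b hab => (ψ.2.monotone hab).1)
  rw [ψ.apply_last_fst h, ψ.apply_zero h] at h1
  simp only [Prod.fst_zero, Fin.val_zero, Nat.sub_zero] at h1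
  simp only [Chain.sign, Chain.consSnd, Fin.sum_univ_succ (n := n), ← pow_add]
  simp [mul_add, Finset.sum_add_distrib, h1, add_comm]

theorem Chain.consFst_injective {D M n : ℕ} :
    Function.Injective (Chain.consFst : Chain D (M + 1) n → Chain (D + 1) (M + 1) (n + 1)) := by
  intro ψ ψ' h
  have h1 := Fin.cons_right_injective (α := fun _ => Fin (D + 1) × Fin (M + 1)) 0
    (congrArg Subtype.val h)
  exact Subtype.ext (((Fin.succAbove_right_injective).prodMap Function.injective_id).comp_left h1)

theorem Chain.consSnd_injective {D M n : ℕ} :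
    Function.Injective (Chain.consSnd : Chain (D + 1) M n → Chain (D + 1) (M + 1) (n + 1)) := by
  intro ψ ψ' h
  have h1 := Fin.cons_right_injective (α := fun _ => Fin (D + 1) × Fin (M + 1)) 0
    (congrArg Subtype.val h)
  exact Subtype.ext ((Function.injective_id.prodMap (Fin.succAbove_right_injective)).comp_left h1)

/-- Once the first coordinate has left `0` it never returns, so the tail of the path can be
translated back by one column. Maximality is needed only for the path to start at the origin. -/
theorem Chain.exists_consFst {D M n : ℕ} (h : D + M = n + 1) (φ : Chain (D + 1) (M + 1) (n + 1))
    (h1 : (φ.1 1).1 ≠ 0) : ∃ ψ : Chain D (M + 1) n, ψ.consFst = φ := by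
  have hne : ∀ k : Fin (n + 1), (φ.1 k.succ).1 ≠ 0 := by
    intro k hk
    have h2 : (φ.1 1).1 ≤ (φ.1 k.succ).1 := (φ.2.monotone (by simp [Fin.le_def])).1
    rw [hk, Fin.le_zero_iff] at h2
    exact h1 h2
  refine ⟨⟨fun k => ((φ.1 k.succ).1.pred (hne k), (φ.1 k.succ).2), ?_⟩, Subtype.ext ?_⟩
  · intro k l hkl
    have h3 := φ.2 (Fin.succ_lt_succ_iff.2 hkl)
    rw [Prod.lt_iff] at h3 ⊢
    simpa using h3
  · refine Eq.trans ?_ (Fin.cons_self_tail φ.1)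
    rw [φ.apply_zero h]
    simp only [Chain.consFst]
    congr 1
    funext k
    simp [Fin.tail]

theorem Chain.exists_consSnd {D M n : ℕ} (h : D + M = n + 1) (φ : Chain (D + 1) (M + 1) (n + 1))
    (h1 : (φ.1 1).1 = 0) : ∃ ψ : Chain (D + 1) M n, ψ.consSnd = φ := by
  have h0 : (φ.1 1).2 ≠ 0 := by
    intro h2
    have h3 : φ.1 0 < φ.1 1 := φ.2 (by simp)
    rw [φ.apply_zero h] at h3
    exact h3.ne (Prod.ext h1.symm h2.symm)
  have hne : ∀ k : Fin (n + 1), (φ.1 k.succ).2 ≠ 0 := by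
    intro k hk
    have h2 : (φ.1 1).2 ≤ (φ.1 k.succ).2 := (φ.2.monotone (by simp [Fin.le_def])).2
    rw [hk, Fin.le_zero_iff] at h2
    exact h0 h2
  refine ⟨⟨fun k => ((φ.1 k.succ).1, (φ.1 k.succ).2.pred (hne k)), ?_⟩, Subtype.ext ?_⟩
  · intro k l hkl
    have h3 := φ.2 (Fin.succ_lt_succ_iff.2 hkl)
    rw [Prod.lt_iff] at h3 ⊢
    simpa using h3
  · refine Eq.trans ?_ (Fin.cons_self_tail φ.1)
    rw [φ.apply_zero h]
    simp only [Chain.consSnd]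
    congr 1
    funext k
    simp [Fin.tail]

variable {A : Type*} [AddCommGroup A]

/-- The signed sum of a function over all chains. -/
def chainSum {D M n : ℕ} (Φ : (Fin (n + 1) → Fin D × Fin M) → A) : A :=
  ∑ φ : Chain D M n, φ.sign • Φ φ.1

theorem chainSum_sub {D M n : ℕ} (Φ Ψ : (Fin (n + 1) → Fin D × Fin M) → A) :
    chainSum (fun φ => Φ φ - Ψ φ) = chainSum Φ - chainSum Ψ := by
  simp [chainSum, smul_sub]

theorem chainSum_zero_left {M n : ℕ} (Φ : (Fin (n + 1) → Fin 0 × Fin M) → A) : chainSum Φ = 0 := by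
  simp [chainSum]

theorem chainSum_zero_right {D n : ℕ} (Φ : (Fin (n + 1) → Fin D × Fin 0) → A) : chainSum Φ = 0 := by
  simp [chainSum]

/-- Maximal chains from `(0, 0)` decompose according to their first step. -/
theorem chainSum_succ {D M n : ℕ} (h : D + M = n + 1)
    (Φ : (Fin (n + 2) → Fin (D + 1) × Fin (M + 1)) → A) :
    chainSum Φ
      = chainSum (n := n) (fun ψ : Fin (n + 1) → Fin D × Fin (M + 1) =>
          Φ (Fin.cons 0 (Prod.map (Fin.succAbove 0) id ∘ ψ)))
        + (-1 : ℤ) ^ D • chainSum (n := n) (fun ψ : Fin (n + 1) → Fin (D + 1) × Fin M =>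
          Φ (Fin.cons 0 (Prod.map id (Fin.succAbove 0) ∘ ψ))) := by
  classical
  unfold chainSum
  rw [← Finset.sum_filter_not_add_sum_filter Finset.univ
    (fun φ : Chain (D + 1) (M + 1) (n + 1) => (φ.1 1).1 = 0), Finset.smul_sum]
  congr 1
  · symm
    refine Finset.sum_nbij Chain.consFst ?_ Chain.consFst_injective.injOn ?_ ?_
    · intro ψ _
      simp [Chain.consFst]
    · intro φ hφ
      obtain ⟨ψ, hψ⟩ := φ.exists_consFst h (by simpa using hφ)
      exact ⟨ψ, by simp, hψ⟩
    · intro ψ _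
      rw [Chain.sign_consFst]
      rfl
  · symm
    refine Finset.sum_nbij Chain.consSnd ?_ Chain.consSnd_injective.injOn ?_ ?_
    · intro ψ _
      -- Without vertical room there is no translated path. Otherwise the path `ψ` is itself maximal
      -- and starts at the origin, so its translate starts in column `0`.
      cases M with
      | zero => exact (ψ.1 0).2.elim0
      | succ M => simp [Chain.consSnd, ψ.apply_zero (D := D) (M := M) (by omega)]
    · intro φ hφ
      obtain ⟨ψ, hψ⟩ := φ.exists_consSnd h (by simpa using hφ)
      exact ⟨ψ, by simp, hψ⟩
    · intro ψ _
      cases M with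
      | zero => exact (ψ.1 0).2.elim0
      | succ M =>
        rw [Chain.sign_consSnd (D := D) (M := M) (by omega), smul_smul]
        rfl

/-- The alternating sum of a function over the faces of a sequence. -/
def faceSum {n : ℕ} {V : Type*} (Φ : (Fin (n + 1) → V) → A) (φ : Fin (n + 2) → V) : A :=
  ∑ i : Fin (n + 2), (-1 : ℤ) ^ (i : ℕ) • Φ (φ ∘ i.succAbove)

/-- The zeroth face forgets `v`. All the others keep it, and their indices, hence their signs, are
shifted by one. -/
theorem faceSum_cons {n : ℕ} {V : Type*} (Φ : (Fin (n + 2) → V) → A) (v : V) (χ : Fin (n + 2) → V) :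
    faceSum Φ (Fin.cons v χ) = Φ χ - faceSum (fun ψ => Φ (Fin.cons v ψ)) χ := by
  unfold faceSum
  rw [Fin.sum_univ_succ, sub_eq_add_neg, ← Finset.sum_neg_distrib]
  congr 1
  · simp only [Fin.val_zero, pow_zero, one_smul]
    rfl
  · refine Finset.sum_congr rfl fun i _ => ?_
    rw [Fin.val_succ, pow_succ, mul_neg_one, neg_smul]
    congr 3
    funext k
    induction k using Fin.cases with
    | zero => simp
    | succ k => simp

theorem prodMap_succAbove_cons_fst {D M n : ℕ} (a : Fin (D + 1)) (χ : Fin n → Fin (D + 1) × Fin (M + 1)) :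
    Prod.map a.succ.succAbove id ∘ (Fin.cons 0 χ : Fin (n + 1) → _)
      = Fin.cons 0 (Prod.map a.succ.succAbove id ∘ χ) := by
  funext k
  induction k using Fin.cases with
  | zero => exact Prod.ext (by simp) rfl
  | succ k => simp

theorem prodMap_succAbove_cons_snd {D M n : ℕ} (b : Fin (M + 1)) (χ : Fin n → Fin (D + 1) × Fin (M + 1)) :
    Prod.map id b.succ.succAbove ∘ (Fin.cons 0 χ : Fin (n + 1) → _)
      = Fin.cons 0 (Prod.map id b.succ.succAbove ∘ χ) := by
  funext k
  induction k using Fin.cases with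
  | zero => exact Prod.ext rfl (by simp)
  | succ k => simp

/-- A face other than the zeroth keeps the origin, so its paths can again be cut after their first
step. After a horizontal step, the simplicial identity `δ_{a+1} δ_0 = δ_0 δ_a` moves the face map
inside the translation; after a vertical step the two maps act on different coordinates. -/
theorem sum_chainSum_succAbove_fst {D M n : ℕ} (h : D + M = n + 1)
    (Φ : (Fin (n + 2) → Fin (D + 2) × Fin (M + 1)) → A) :
    ∑ a : Fin (D + 2), (-1 : ℤ) ^ (a : ℕ) • chainSum (n := n + 1)
        (fun ψ : Fin (n + 2) → Fin (D + 1) × Fin (M + 1) => Φ (Prod.map a.succAbove id ∘ ψ))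
      = chainSum (n := n + 1) (fun ψ : Fin (n + 2) → Fin (D + 1) × Fin (M + 1) =>
          Φ (Prod.map (Fin.succAbove 0) id ∘ ψ))
        - ∑ a : Fin (D + 1), (-1 : ℤ) ^ (a : ℕ) • chainSum (n := n)
          (fun ψ : Fin (n + 1) → Fin D × Fin (M + 1) =>
            Φ (Fin.cons 0 (Prod.map (Fin.succAbove 0) id ∘ Prod.map a.succAbove id ∘ ψ)))
        - (-1 : ℤ) ^ D • ∑ a : Fin (D + 1), (-1 : ℤ) ^ (a : ℕ) • chainSum (n := n)
          (fun ψ : Fin (n + 1) → Fin (D + 1) × Fin M =>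
            Φ (Fin.cons 0 (Prod.map id (Fin.succAbove 0) ∘ Prod.map a.succ.succAbove id ∘ ψ))) := by
  rw [Fin.sum_univ_succ, Fin.val_zero, pow_zero, one_smul, sub_sub, sub_eq_add_neg, Finset.smul_sum,
    ← Finset.sum_add_distrib, ← Finset.sum_neg_distrib]
  congr 1
  refine Finset.sum_congr rfl fun a _ => ?_
  rw [chainSum_succ h, Fin.val_succ, pow_succ, mul_neg_one, neg_smul, smul_add, smul_comm]
  simp only [prodMap_succAbove_cons_fst]
  congr 4
  funext ψ
  congr 2
  funext k
  exact Prod.ext (by simp) rfl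

/-- The mirror image for faces of the second factor: now a vertical first step uses the simplicial
identity. -/
theorem sum_chainSum_succAbove_snd {D M n : ℕ} (h : D + M = n + 1)
    (Φ : (Fin (n + 2) → Fin (D + 1) × Fin (M + 2)) → A) :
    ∑ b : Fin (M + 2), (-1 : ℤ) ^ (b : ℕ) • chainSum (n := n + 1)
        (fun ψ : Fin (n + 2) → Fin (D + 1) × Fin (M + 1) => Φ (Prod.map id b.succAbove ∘ ψ))
      = chainSum (n := n + 1) (fun ψ : Fin (n + 2) → Fin (D + 1) × Fin (M + 1) =>
          Φ (Prod.map id (Fin.succAbove 0) ∘ ψ))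
        - ∑ b : Fin (M + 1), (-1 : ℤ) ^ (b : ℕ) • chainSum (n := n)
          (fun ψ : Fin (n + 1) → Fin D × Fin (M + 1) =>
            Φ (Fin.cons 0 (Prod.map (Fin.succAbove 0) id ∘ Prod.map id b.succ.succAbove ∘ ψ)))
        - (-1 : ℤ) ^ D • ∑ b : Fin (M + 1), (-1 : ℤ) ^ (b : ℕ) • chainSum (n := n)
          (fun ψ : Fin (n + 1) → Fin (D + 1) × Fin M =>
            Φ (Fin.cons 0 (Prod.map id (Fin.succAbove 0) ∘ Prod.map id b.succAbove ∘ ψ))) := by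
  rw [Fin.sum_univ_succ, Fin.val_zero, pow_zero, one_smul, sub_sub, sub_eq_add_neg, Finset.smul_sum,
    ← Finset.sum_add_distrib, ← Finset.sum_neg_distrib]
  congr 1
  refine Finset.sum_congr rfl fun b _ => ?_
  rw [chainSum_succ h, Fin.val_succ, pow_succ, mul_neg_one, neg_smul, smul_add, smul_comm]
  simp only [prodMap_succAbove_cons_snd]
  congr 5
  funext ψ
  congr 2
  funext k
  exact Prod.ext rfl (by simp)

/-- The boundary of the shuffle product of the fundamental simplices of `Δ^D` and `Δ^M` is given by
the Leibniz rule. -/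
theorem chainSum_faceSum {D M n : ℕ} (h : D + M = n + 1)
    (Φ : (Fin (n + 1) → Fin (D + 1) × Fin (M + 1)) → A) :
    chainSum (faceSum Φ)
      = ∑ a : Fin (D + 1), (-1 : ℤ) ^ (a : ℕ) • chainSum (n := n)
          (fun ψ : Fin (n + 1) → Fin D × Fin (M + 1) => Φ (Prod.map a.succAbove id ∘ ψ))
        + (-1 : ℤ) ^ D • ∑ b : Fin (M + 1), (-1 : ℤ) ^ (b : ℕ) • chainSum (n := n)
          (fun ψ : Fin (n + 1) → Fin (D + 1) × Fin M => Φ (Prod.map id b.succAbove ∘ ψ)) := by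
  induction n generalizing D M with
  | zero =>
    -- In total dimension one the product is a single edge; its two faces are the endpoint and the
    -- origin.
    have hconst : ∀ χ : Fin 1 → Fin (D + 1) × Fin (M + 1),
        (Fin.cons 0 χ : Fin 2 → _) ∘ Fin.succAbove 1 = fun _ => 0 := by
      intro χ
      funext k
      fin_cases k
      rfl
    have hface : ∀ χ : Fin 1 → Fin (D + 1) × Fin (M + 1),
        faceSum Φ (Fin.cons 0 χ) = Φ χ - Φ (fun _ => 0) := by
      intro χ
      rw [faceSum, Fin.sum_univ_two, hconst, sub_eq_add_neg]
      simp only [Fin.val_zero, pow_zero, one_smul, Fin.val_one, pow_one, neg_smul]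
      rfl
    rw [chainSum_succ h]
    simp only [hface]
    obtain ⟨rfl, rfl⟩ | ⟨rfl, rfl⟩ : (D = 1 ∧ M = 0) ∨ (D = 0 ∧ M = 1) := by omega
    · simp only [chainSum_zero_right, smul_zero, Finset.sum_const_zero, add_zero]
      refine Eq.trans ?_ (Fin.sum_univ_two _).symm
      rw [chainSum_sub, sub_eq_add_neg, Fin.val_zero, Fin.val_one, pow_zero, pow_one, one_smul,
        neg_one_smul]
      congr 3
      funext ψ
      congr 1
      funext k
      exact Prod.ext (by simp [Subsingleton.elim (α := Fin 1) (ψ k).1 0])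
        (Subsingleton.elim (α := Fin 1) _ _)
    · simp only [chainSum_zero_left, smul_zero, Finset.sum_const_zero, zero_add, pow_zero, one_smul]
      refine Eq.trans ?_ (Fin.sum_univ_two _).symm
      rw [chainSum_sub, sub_eq_add_neg, Fin.val_zero, Fin.val_one, pow_zero, pow_one, one_smul,
        neg_one_smul]
      congr 3
      funext ψ
      congr 1
      funext k
      exact Prod.ext (Subsingleton.elim (α := Fin 1) _ _)
        (by simp [Subsingleton.elim (α := Fin 1) (ψ k).2 0])
  | succ n ih =>
    rw [chainSum_succ h]
    simp only [faceSum_cons, chainSum_sub]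
    -- When a factor is a point, only one kind of step exists, and only the induction hypothesis for
    -- that kind is needed.
    rcases D with _ | D
    · obtain ⟨M, rfl⟩ : ∃ M', M = M' + 1 := ⟨M - 1, by omega⟩
      have hY := ih (D := 0) (M := M) (by omega)
        (fun ψ => Φ (Fin.cons 0 (Prod.map id (Fin.succAbove 0) ∘ ψ)))
      rw [sum_chainSum_succAbove_snd (D := 0) (M := M) (by omega)]
      simp only [chainSum_zero_left, smul_zero, Finset.sum_const_zero, zero_add, sub_zero,
        pow_zero, one_smul] at hY ⊢
      exact congrArg _ hY
    · rcases M with _ | M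
      · have hX := ih (D := D) (M := 0) (by omega)
          (fun ψ => Φ (Fin.cons 0 (Prod.map (Fin.succAbove 0) id ∘ ψ)))
        rw [sum_chainSum_succAbove_fst (D := D) (M := 0) (by omega)]
        simp only [chainSum_zero_right, smul_zero, Finset.sum_const_zero, add_zero, sub_zero] at hX ⊢
        exact congrArg _ hX
      · have hX := ih (D := D) (M := M + 1) (by omega)
          (fun ψ => Φ (Fin.cons 0 (Prod.map (Fin.succAbove 0) id ∘ ψ)))
        have hY := ih (D := D + 1) (M := M) (by omega)
          (fun ψ => Φ (Fin.cons 0 (Prod.map id (Fin.succAbove 0) ∘ ψ)))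
        rw [sum_chainSum_succAbove_fst (D := D) (M := M + 1) (by omega),
          sum_chainSum_succAbove_snd (D := D + 1) (M := M) (by omega)]
        -- Translating a path and then taking faces agrees definitionally with the reverse order;
        -- the detour through `z` puts the induction hypothesis in the form occurring in the goal.
        have hX' : ∀ z, z = chainSum (n := n + 1) (fun ψ : Fin (n + 2) → Fin (D + 1) × Fin (M + 2) =>
            faceSum (fun ψ => Φ (Fin.cons 0 ψ)) (Prod.map (Fin.succAbove 0) id ∘ ψ)) → z = _ :=
          fun z hz => hz.trans hX
        have hY' : ∀ z, z = chainSum (n := n + 1) (fun ψ : Fin (n + 2) → Fin (D + 2) × Fin (M + 1) =>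
            faceSum (fun ψ => Φ (Fin.cons 0 ψ)) (Prod.map id (Fin.succAbove 0) ∘ ψ)) → z = _ :=
          fun z hz => hz.trans hY
        rw [hX' _ rfl, hY' _ rfl]
        -- The terms split off here come from paths that jump diagonally from the origin. Each
        -- arises twice, as the corner of a horizontal-vertical and of a vertical-horizontal start,
        -- and `hcomm` identifies the two. Their signs `(-1)^D` and `(-1)^(D+1)` are opposite, so
        -- these interior faces cancel.
        rw [Fin.sum_univ_succ (n := M + 1), Fin.sum_univ_succ (n := D + 1)]
        simp only [Fin.val_zero, pow_zero, one_smul, Fin.val_succ, pow_succ, mul_neg_one, neg_smul,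
          Finset.sum_neg_distrib]
        have hcomm : ∀ ψ : Fin (n + 1) → Fin (D + 1) × Fin (M + 1),
            Prod.map id (Fin.succAbove (0 : Fin (M + 2))) ∘ Prod.map (Fin.succAbove (0 : Fin (D + 2))) id ∘ ψ
              = Prod.map (Fin.succAbove 0) id ∘ Prod.map id (Fin.succAbove 0) ∘ ψ := fun _ => rfl
        simp only [hcomm, smul_add, smul_sub, smul_neg]
        abel

end LatticePaths

/-! ### Flat sections, frames and closedness of `ev^* λ` -/

section FlatSections

open CategoryTheory

variable {G : Type} [Group G] {π : G →* ℤˣ} {A : Type} [AddCommGroup A] {X : Type u} [TopologicalSpace X]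
  {D : DoubleCover X} {n : ℕ}

theorem preconnectedSpace_stdSimplex (n : ℕ) : PreconnectedSpace (stdSimplex ℝ (Fin (n + 1))) :=
  isPreconnected_iff_preconnectedSpace.1 (convex_stdSimplex ℝ (Fin (n + 1))).isPreconnected

theorem PrincipalBundle.act_injective (P : PrincipalBundle G X) (p : P.total) :
    Function.Injective (P.act p) := fun _ g' h =>
  (P.existsUnique_act p (P.act p g') (P.proj_act p g').symm).unique h rfl

/-- Two flat sections along a simplex differ by a constant group element. -/
theorem exists_act_eq_of_proj_eq (P : PrincipalBundle G X) (l l' : Sing n P.total)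
    (h : ∀ p, P.proj (l p) = P.proj (l' p)) : ∃ g, ∀ p, P.act (l p) g = l' p := by
  obtain ⟨g, hg, -⟩ := P.existsUnique_act _ _ (h (stdSimplex.vertex 0))
  have := preconnectedSpace_stdSimplex n
  refine ⟨g, fun p => ?_⟩
  -- Two lifts of a connected simplex to a covering agree everywhere if they agree at one vertex.
  have h1 := P.isCovering.eq_of_comp_eq ((P.continuous_act g).comp l.continuous) l'.continuous
    (by funext q; simpa [P.proj_act] using h q) (stdSimplex.vertex 0) hg
  exact congrFun h1 p

open Classical in
/-- The sign comparing the point `[e, 1]` of `Ind_π(P)`, carried to `D` by the framing, with `q`. -/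
def framingSign (P : TwistedBundle π D) (e : P.bundle.total) (q : D.total) : ℤ :=
  if P.framing (Ind.mk π P.bundle e 1) = q then 1 else -1

/-- In `P ×_G ℤ₂` one has `[e g, 1] = [e, π(g)]`, and the framing carries the sign to the deck
involution. The point `q` must lie over the same base point as `e`: elsewhere the sign has the
constant default value `-1`. -/
theorem framingSign_act (P : TwistedBundle π D) (e : P.bundle.total) (q : D.total)
    (h : D.proj q = P.bundle.proj e) (g : G) :
    framingSign P (P.bundle.act e g) q = ((π g : ℤˣ) : ℤ) * framingSign P e q := by
  unfold framingSign
  rw [Ind.mk_act, mul_one]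
  rcases Int.units_eq_one_or (π g) with hg | hg
  · rw [hg, Units.val_one, one_mul]
  · rw [hg, P.framing_neg]
    have h1 : D.proj q = D.proj (P.framing (Ind.mk π P.bundle e 1)) := by rw [P.proj_framing, h]
    rcases (D.proj_eq_iff _ _).1 h1 with h2 | h2
    · rw [h2, if_neg (D.swap_ne _), if_pos rfl]
      simp
    · rw [h2, D.swap_swap, if_pos rfl, if_neg (D.swap_ne _)]
      simp

theorem framingSign_map {P Q : TwistedBundle π D} (f : TwistedBundle.Hom P Q) (e : P.bundle.total)
    (q : D.total) : framingSign Q (f.map e) q = framingSign P e q := by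
  unfold framingSign
  rw [f.framing_map]

/-- The framing sign is constant along a flat section. -/
theorem framingSign_flat (P : TwistedBundle π D) (l : Sing n P.bundle.total) (σ : Sing n D.total)
    (h : ∀ p, P.bundle.proj (l p) = D.proj (σ p)) (p p' : stdSimplex ℝ (Fin (n + 1))) :
    framingSign P (l p) (σ p) = framingSign P (l p') (σ p') := by
  have := preconnectedSpace_stdSimplex n
  have hcont : Continuous fun p => P.framing (Ind.mk π P.bundle (l p) 1) :=
    P.framing.continuous.comp ((continuous_quotient_mk' (s := indSetoid π P.bundle)).comp
      (l.continuous.prodMk continuous_const))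
  have key : ∀ p p', P.framing (Ind.mk π P.bundle (l p) 1) = σ p →
      P.framing (Ind.mk π P.bundle (l p') 1) = σ p' := by
    intro p p' hp
    have h1 := D.isCovering.eq_of_comp_eq hcont σ.continuous
      (by funext q; simp [P.proj_framing, h]) p hp
    exact congrFun h1 p'
  unfold framingSign
  congr 1
  exact propext ⟨key p p', key p' p⟩

variable (t : FibrePoints π D)

theorem act_vertexFrame (α : ComposableArrows (TwistedBundle π D) n) (σ : Sing n X) (k : Fin (n + 1)) :
    (α.obj k).bundle.act (TwistedBundle.Hom.map (α.map (homOfLE (Fin.zero_le k)))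
      (flatSection (α.obj 0).bundle σ (stdSimplex.vertex k))) (vertexFrame t α σ k)
      = t (α.obj k) (σ (stdSimplex.vertex k)) :=
  ((α.obj k).bundle.existsUnique_act _ _
    (by rw [TwistedBundle.Hom.proj_map, proj_flatSection, (t _ _).2])).choose_spec.1

/-- The image of a simplex under `ev` may be computed with any flat section. -/
theorem evSimplex_eq (α : ComposableArrows (TwistedBundle π D) n) (σ : Sing n X)
    (l : Sing n (α.obj 0).bundle.total) (hl : ∀ p, (α.obj 0).bundle.proj (l p) = σ p)
    (a : Fin (n + 1) → G)
    (ha : ∀ k, (α.obj k).bundle.act (TwistedBundle.Hom.map (α.map (homOfLE (Fin.zero_le k)))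
      (l (stdSimplex.vertex k))) (a k) = t (α.obj k) (σ (stdSimplex.vertex k))) :
    evSimplex t α σ = fun i => (a i.castSucc)⁻¹ * a i.succ := by
  obtain ⟨g, hg⟩ := exists_act_eq_of_proj_eq _ (flatSection (α.obj 0).bundle σ) l
    (fun p => by rw [proj_flatSection, hl])
  -- Another flat section changes all frames by the same left factor, which cancels in `aᵢ⁻¹ aᵢ₊₁`.
  have h : ∀ k, vertexFrame t α σ k = g * a k := by
    intro k
    apply (α.obj k).bundle.act_injective
    rw [act_vertexFrame, PrincipalBundle.act_mul, ← TwistedBundle.Hom.map_act, hg, ha]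
  funext i
  simp [evSimplex, h]

theorem evSign_eq (α : ComposableArrows (TwistedBundle π D) n) (σ : Sing n D.total)
    (e : (α.obj 0).bundle.total) (g : G)
    (h : (α.obj 0).bundle.act e g
      = t (α.obj 0) (D.proj (σ (stdSimplex.vertex 0)))) :
    evSign t α σ = ((π g : ℤˣ) : ℤ) * framingSign (α.obj 0) e (σ (stdSimplex.vertex 0)) := by
  rw [← framingSign_act, h]
  · rfl
  · rw [← (α.obj 0).bundle.proj_act e g, h, (t _ _).2]

theorem simplexMap_vertex {k n : ℕ} (f : Fin (k + 1) → Fin (n + 1)) (i : Fin (k + 1)) :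
    simplexMap f (stdSimplex.vertex i) = stdSimplex.vertex (f i) :=
  stdSimplex.map_vertex f i

theorem TwistedBundle.map_map (α : ComposableArrows (TwistedBundle π D) n) {i j k : Fin (n + 1)}
    (f : i ⟶ j) (g : j ⟶ k) (f' : i ⟶ k) (x : (α.obj i).bundle.total) :
    TwistedBundle.Hom.map (α.map g) (TwistedBundle.Hom.map (α.map f) x)
      = TwistedBundle.Hom.map (α.map f') x := by
  rw [Subsingleton.elim f' (f ≫ g), α.map_comp]
  rfl

/-- The value of `ev^* λ` on a face, or degeneration, of a simplex of `Bun × X` in terms of the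
frames at the vertices of that simplex. -/
theorem evPullback_nerveComp (lam : GroupCochain G A n) {k : ℕ} (f : Fin (n + 1) → Fin (k + 1))
    (hf : Monotone f) (β : ComposableArrows (TwistedBundle π D) k) (τ : Sing k D.total) :
    (evPullback t lam).1 (nerveComp f hf β) (τ.comp (simplexMap f))
      = (((π (vertexFrame t β (D.projMap.comp τ) (f 0)) : ℤˣ) : ℤ)
          * framingSign (β.obj 0) (flatSection (β.obj 0).bundle (D.projMap.comp τ) (stdSimplex.vertex 0))
            (τ (stdSimplex.vertex 0))) •
        lam (fun i => (vertexFrame t β (D.projMap.comp τ) (f i.castSucc))⁻¹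
          * vertexFrame t β (D.projMap.comp τ) (f i.succ)) := by
  set σ := D.projMap.comp τ with hσ
  set b := vertexFrame t β σ with hb
  set L := flatSection (β.obj 0).bundle σ with hL
  -- The flat section for the new simplex is the old one, transported to its initial bundle and
  -- reparametrised. With respect to it the frame at vertex `k` is the old frame at `f k`.
  let F := β.map (homOfLE (Fin.zero_le (f 0)))
  let l : Sing n ((nerveComp f hf β).obj 0).bundle.total :=
    ((TwistedBundle.Hom.map F).comp L).comp (simplexMap f)
  have hl : ∀ p, ((nerveComp f hf β).obj 0).bundle.proj (l p)
      = (D.projMap.comp (τ.comp (simplexMap f))) p := by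
    intro p
    exact (TwistedBundle.Hom.proj_map F _).trans (proj_flatSection _ _ _)
  have ha : ∀ k, ((nerveComp f hf β).obj k).bundle.act
      (TwistedBundle.Hom.map ((nerveComp f hf β).map (homOfLE (Fin.zero_le k)))
        (l (stdSimplex.vertex k))) (b (f k))
      = t ((nerveComp f hf β).obj k) ((D.projMap.comp (τ.comp (simplexMap f))) (stdSimplex.vertex k)) := by
    intro k
    have h1 := act_vertexFrame t β σ (f k)
    have h2 := TwistedBundle.map_map β (homOfLE (Fin.zero_le (f 0))) (homOfLE (hf (Fin.zero_le k)))
      (homOfLE (Fin.zero_le (f k))) (L (stdSimplex.vertex (f k)))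
    have h3 : l (stdSimplex.vertex k) = TwistedBundle.Hom.map F (L (stdSimplex.vertex (f k))) :=
      congrArg (fun z => TwistedBundle.Hom.map F (L z)) (simplexMap_vertex f k)
    have h4 : (D.projMap.comp (τ.comp (simplexMap f))) (stdSimplex.vertex k)
      = σ (stdSimplex.vertex (f k)) := congrArg σ (simplexMap_vertex f k)
    rw [h3, h4]
    rw [← h2] at h1
    exact h1
  change evSign t (nerveComp f hf β) (τ.comp (simplexMap f)) • lam _ = _
  rw [evSimplex_eq t (nerveComp f hf β) _ l hl (fun k => b (f k)) ha]
  congr 1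
  have h0 : TwistedBundle.Hom.map ((nerveComp f hf β).map (homOfLE (Fin.zero_le 0)))
      (l (stdSimplex.vertex 0)) = l (stdSimplex.vertex 0) := by
    rw [Subsingleton.elim (homOfLE (Fin.zero_le (0 : Fin (n + 1)))) (𝟙 _), CategoryTheory.Functor.map_id]
    rfl
  have h1 := ha 0
  rw [h0] at h1
  rw [evSign_eq t (nerveComp f hf β) _ _ _ h1]
  congr 1
  -- Bundle morphisms preserve the framing sign, and so does moving along the flat section; hence it
  -- can be read off at vertex `0` of the original simplex.
  refine (framingSign_map F _ _).trans ?_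
  change framingSign (β.obj 0) (L (simplexMap f (stdSimplex.vertex 0)))
    (τ (simplexMap f (stdSimplex.vertex 0))) = _
  exact framingSign_flat (β.obj 0) L τ (fun p => proj_flatSection _ _ _) _ _

/-- Omitting an inner vertex multiplies its two adjacent edges, as the frame there cancels. Omitting
the last vertex drops the last edge, as `Fin.contractNth` does at its final index. -/
theorem inv_mul_succAbove_eq_contractNth (a : Fin (n + 2) → G) (j : Fin (n + 1)) :
    (fun i : Fin n => (a (j.succ.succAbove i.castSucc))⁻¹ * a (j.succ.succAbove i.succ))
      = Fin.contractNth j (· * ·) (fun i => (a i.castSucc)⁻¹ * a i.succ) := by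
  funext i
  rcases lt_trichotomy (i : ℕ) j with h | h | h
  · rw [Fin.contractNth_apply_of_lt _ _ _ _ h,
      Fin.succAbove_of_castSucc_lt _ _ (by simp [Fin.lt_def]; omega),
      Fin.succAbove_of_castSucc_lt _ _ (by simp [Fin.lt_def]; omega)]
    rfl
  · rw [Fin.contractNth_apply_of_eq _ _ _ _ h,
      Fin.succAbove_of_castSucc_lt _ _ (by simp [Fin.lt_def]; omega),
      Fin.succAbove_of_le_castSucc _ _ (by simp [Fin.le_def]; omega)]
    simp only [Fin.succ_castSucc]
    group
  · rw [Fin.contractNth_apply_of_gt _ _ _ _ h,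
      Fin.succAbove_of_le_castSucc _ _ (by simp [Fin.le_def]; omega),
      Fin.succAbove_of_le_castSucc _ _ (by simp [Fin.le_def]; omega)]
    rfl

theorem IsTwistedCocycle.sum_eq_zero {lam : GroupCochain G A n} (h : IsTwistedCocycle π lam)
    (g : Fin (n + 1) → G) :
    ((π (g 0) : ℤˣ) : ℤ) • lam (fun i => g i.succ)
      + ∑ j : Fin (n + 1), (-1 : ℤ) ^ ((j : ℕ) + 1) • lam (Fin.contractNth j (· * ·) g) = 0 :=
  congrFun h g

/-- `ev^* λ` is closed if `λ` is a cocycle. -/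
theorem sum_evPullback_face {lam : GroupCochain G A n} (h : IsTwistedCocycle π lam)
    (β : ComposableArrows (TwistedBundle π D) (n + 1)) (τ : Sing (n + 1) D.total) :
    ∑ i : Fin (n + 2), (-1 : ℤ) ^ (i : ℕ) • (evPullback t lam).1
      (nerveComp i.succAbove (Fin.strictMono_succAbove i).monotone β)
      (τ.comp (simplexMap i.succAbove)) = 0 := by
  simp only [evPullback_nerveComp]
  set a := vertexFrame t β (D.projMap.comp τ)
  set ε := framingSign (β.obj 0) (flatSection (β.obj 0).bundle (D.projMap.comp τ) (stdSimplex.vertex 0))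
            (τ (stdSimplex.vertex 0))
  have h1 := h.sum_eq_zero (fun i => (a i.castSucc)⁻¹ * a i.succ)
  -- The factor is the sign common to all faces that contain vertex `0`. For the remaining face,
  -- `π(a₀) π(a₀⁻¹ a₁) = π(a₁)` is the sign of a simplex starting at vertex `1`.
  have h2 := congrArg (fun z => (((π (a 0) : ℤˣ) : ℤ) * ε) • z) h1
  simp only [smul_add, Finset.smul_sum, smul_zero] at h2
  rw [Fin.sum_univ_succ, ← h2]
  congr 1
  · simp only [Fin.val_zero, pow_zero, smul_smul, Fin.succAbove_zero, Fin.castSucc_zero,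
      map_mul, map_inv, Units.val_mul, Fin.succ_castSucc, Int.units_inv_eq_self]
    congr 1
    rcases Int.units_eq_one_or (π (a 0)) with h3 | h3 <;> simp [h3, mul_comm]
  · refine Finset.sum_congr rfl fun j _ => ?_
    rw [inv_mul_succAbove_eq_contractNth, Fin.succ_succAbove_zero, smul_comm, Fin.val_succ]

/-! ### Naturality of `ev^*` under restriction of bundles -/

variable {N : Type u} [TopologicalSpace N] {j : C(N, X)} {D' : DoubleCover N}

theorem framingSign_restrict (h : DoubleCover.Over j D' D) (P : TwistedBundle π D)
    (e : (P.restrict h).bundle.total) (q : D'.total) (he : D'.proj q = (P.restrict h).bundle.proj e) :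
    framingSign (P.restrict h) e q = framingSign P e.1.2 (h.lift q) := by
  unfold framingSign
  congr 1
  refine propext ?_
  change h.iso.symm ⟨(e.1.1, P.framing (Ind.mk π P.bundle e.1.2 1)), _⟩ = q ↔ _ = (h.iso q).1.2
  rw [Homeomorph.symm_apply_eq]
  constructor
  · intro h1
    rw [← h1]
  · intro h1
    exact Subtype.ext (Prod.ext (he.symm.trans (h.iso_proj q).symm) h1)

/-- Naturality of `ev^*` with respect to restriction of bundles. -/
theorem evPullback_restrict (h : DoubleCover.Over j D' D) {t : FibrePoints π D} {s : FibrePoints π D'}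
    (hts : FibrePoints.Compatible h t s) (lam : GroupCochain G A n)
    (α : ComposableArrows (TwistedBundle π D) n) (σ : Sing n D'.total) :
    (evPullback s lam).1 (α ⋙ restrictFunctor π h) σ = (evPullback t lam).1 α (h.lift.comp σ) := by
  have hproj : D.projMap.comp (h.lift.comp σ) = j.comp (D'.projMap.comp σ) := by
    ext p
    exact (h.iso (σ p)).2.symm.trans (congrArg j (h.iso_proj _))
  change evSign s (α ⋙ restrictFunctor π h) σ • lam (evSimplex s (α ⋙ restrictFunctor π h) (D'.projMap.comp σ))
    = evSign t α (h.lift.comp σ) • lam (evSimplex t α (D.projMap.comp (h.lift.comp σ)))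
  rw [hproj]
  congr 1
  · refine (framingSign_restrict h (α.obj 0) _ _ (s _ _).2.symm).trans ?_
    have h1 := hts (α.obj 0) (D'.proj (σ (stdSimplex.vertex 0)))
    change framingSign (α.obj 0) (s ((α.obj 0).restrict h) (D'.proj (σ (stdSimplex.vertex 0)))).1.1.2
      (h.lift (σ (stdSimplex.vertex 0))) = framingSign (α.obj 0)
        (t (α.obj 0) (D.projMap.comp (h.lift.comp σ) (stdSimplex.vertex 0))).1 _
    rw [h1, hproj]
    rfl
  · congr 1
    -- A flat section of `P` along `j ∘ σ`, paired with `σ` itself, is a flat section of `j^* P`. By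
    -- compatibility of the fibre points the frames on `X` also serve on `N`.
    let L := flatSection (α.obj 0).bundle (j.comp (D'.projMap.comp σ))
    let l : Sing n ((α ⋙ restrictFunctor π h).obj 0).bundle.total :=
      ⟨fun p => ⟨(D'.projMap (σ p), L p), (proj_flatSection (α.obj 0).bundle (j.comp (D'.projMap.comp σ)) p).symm⟩, by
        refine Continuous.subtype_mk ?_ _
        exact (D'.projMap.continuous.comp σ.continuous).prodMk L.continuous⟩
    refine evSimplex_eq s (α ⋙ restrictFunctor π h) _ l (fun p => rfl)
      (vertexFrame t α (j.comp (D'.projMap.comp σ))) ?_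
    intro k
    refine Subtype.ext (Prod.ext ?_ ?_)
    · exact (s ((α ⋙ restrictFunctor π h).obj k) ((D'.projMap.comp σ) (stdSimplex.vertex k))).2.symm
    · refine (act_vertexFrame t α _ k).trans ?_
      exact (hts _ _).symm

end FlatSections

/-! ### Cross products and Stokes' formula -/

section CrossProduct

open CategoryTheory

variable {A : Type} [AddCommGroup A] {B : Type*} [Category B] {X : Type u} [TopologicalSpace X]
  {D : DoubleCover X}

open Classical in
/-- The value of `F` on the simplex of `α × σ` given by a chain of vertices of `Δ^d × Δ^m`. -/
def chainValue {d m n : ℕ} (F : ProductCochain A B D n) (α : ComposableArrows B d)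
    (σ : Sing m D.total) (φ : Fin (n + 1) → Fin (d + 1) × Fin (m + 1)) : A :=
  -- The Leibniz rule takes functions of arbitrary sequences. The default value `0` is never met,
  -- since strictly increasing chains and their faces are monotone.
  if hφ : Monotone φ then
    F.1 (nerveComp (fun i => (φ i).1) (fun _ _ h => (hφ h).1) α)
      (σ.comp (simplexMap fun i => (φ i).2))
  else 0

theorem chainValue_of_monotone {d m n : ℕ} (F : ProductCochain A B D n) (α : ComposableArrows B d)
    (σ : Sing m D.total) {φ : Fin (n + 1) → Fin (d + 1) × Fin (m + 1)} (hφ : Monotone φ) :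
    chainValue F α σ φ = F.1 (nerveComp (fun i => (φ i).1) (fun _ _ h => (hφ h).1) α)
      (σ.comp (simplexMap fun i => (φ i).2)) :=
  dif_pos hφ

theorem chainSum_congr {D M n : ℕ} {Φ Ψ : (Fin (n + 1) → Fin D × Fin M) → A}
    (h : ∀ φ, StrictMono φ → Φ φ = Ψ φ) : chainSum Φ = chainSum Ψ :=
  Finset.sum_congr rfl fun φ _ => by rw [h φ.1 φ.2]

theorem crossValue_eq_chainSum {d m n : ℕ} (F : ProductCochain A B D n) (α : ComposableArrows B d)
    (σ : Sing m D.total) : crossValue F α σ = chainSum (chainValue F α σ) := by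
  unfold crossValue chainSum
  refine Fintype.sum_congr _ _ fun φ => ?_
  rw [chainValue_of_monotone F α σ φ.2.monotone]
  rfl

theorem simplexMap_comp {a b c : ℕ} (f : Fin (a + 1) → Fin (b + 1)) (g : Fin (b + 1) → Fin (c + 1)) :
    (simplexMap g).comp (simplexMap f) = simplexMap (g ∘ f) := by
  ext p : 1
  exact stdSimplex.map_comp_apply f g p

/-- Closed cochains on the product of a groupoid and a space. -/
def ProductCochain.IsClosed {n : ℕ} (F : ProductCochain A B D n) : Prop :=
  ∀ (β : ComposableArrows B (n + 1)) (τ : Sing (n + 1) D.total),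
    ∑ i : Fin (n + 2), (-1 : ℤ) ^ (i : ℕ) •
      F.1 (nerveComp i.succAbove (Fin.strictMono_succAbove i).monotone β)
        (τ.comp (simplexMap i.succAbove)) = 0

/-- A closed cochain vanishes on the boundary of a product of simplices. -/
theorem chainSum_faceSum_chainValue {d m n : ℕ} (F : ProductCochain A B D n)
    (hF : F.IsClosed) (α : ComposableArrows B d) (σ : Sing m D.total) :
    chainSum (n := n + 1) (faceSum (chainValue F α σ)) = 0 := by
  refine Finset.sum_eq_zero fun φ _ => ?_
  have h := hF (nerveComp (fun i => (φ.1 i).1) (fun _ _ h => (φ.2.monotone h).1) α)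
    (σ.comp (simplexMap fun i => (φ.1 i).2))
  convert smul_zero φ.sign
  rw [← h]
  refine Finset.sum_congr rfl fun i _ => ?_
  rw [chainValue_of_monotone _ _ _ (φ.2.monotone.comp (Fin.strictMono_succAbove i).monotone),
    ContinuousMap.comp_assoc, simplexMap_comp]
  rfl

/-- Identifies the terms of the Leibniz rule coming from the first factor with cross products of
faces of `α`; `chainSum_chainValue_snd` does so for `σ`. -/
theorem chainSum_chainValue_fst {d m n : ℕ} (F : ProductCochain A B D n) (α : ComposableArrows B (d + 1))
    (σ : Sing m D.total) (a : Fin (d + 2)) :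
    chainSum (fun ψ : Fin (n + 1) → Fin (d + 1) × Fin (m + 1) =>
        chainValue F α σ (Prod.map a.succAbove id ∘ ψ))
      = crossValue F (nerveComp a.succAbove (Fin.strictMono_succAbove a).monotone α) σ := by
  rw [crossValue_eq_chainSum]
  refine chainSum_congr fun ψ hψ => ?_
  rw [chainValue_of_monotone _ _ _ hψ.monotone, chainValue_of_monotone _ _ _
    (((Fin.strictMono_succAbove a).monotone.prodMap monotone_id).comp hψ.monotone)]
  rfl

theorem chainSum_chainValue_snd {d m n : ℕ} (F : ProductCochain A B D n) (α : ComposableArrows B d)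
    (σ : Sing (m + 1) D.total) (b : Fin (m + 2)) :
    chainSum (fun ψ : Fin (n + 1) → Fin (d + 1) × Fin (m + 1) =>
        chainValue F α σ (Prod.map id b.succAbove ∘ ψ))
      = crossValue F α (σ.comp (simplexMap b.succAbove)) := by
  rw [crossValue_eq_chainSum]
  refine chainSum_congr fun ψ hψ => ?_
  rw [chainValue_of_monotone _ _ _ hψ.monotone, chainValue_of_monotone _ _ _
    ((monotone_id.prodMap (Fin.strictMono_succAbove b).monotone).comp hψ.monotone),
    ContinuousMap.comp_assoc, simplexMap_comp]
  rfl

theorem pushforward_simplexChain {d m n : ℕ} (h : d + m = n) (F : ProductCochain A B D n)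
    (α : ComposableArrows B d) (σ : Sing m D.total) :
    pushforward (simplexChain σ) h F α = crossValue F α σ := by
  simp [pushforward, simplexChain]

theorem pushforward_add {d m n : ℕ} (h : d + m = n) (F : ProductCochain A B D n)
    (c c' : TwistedChain D m) : pushforward (c + c') h F = pushforward c h F + pushforward c' h F :=
  funext fun _ => map_add _ _ _

theorem pushforward_zero {d m n : ℕ} (h : d + m = n) (F : ProductCochain A B D n) :
    pushforward (0 : TwistedChain D m) h F = 0 :=
  funext fun _ => map_zero _

theorem pushforward_smul {d m n : ℕ} (h : d + m = n) (F : ProductCochain A B D n) (z : ℤ)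
    (c : TwistedChain D m) : pushforward (z • c) h F = z • pushforward c h F :=
  funext fun _ => map_zsmul _ _ _

theorem pushforward_sum {d m n : ℕ} (h : d + m = n) (F : ProductCochain A B D n) {ι : Type*}
    (s : Finset ι) (c : ι → TwistedChain D m) :
    pushforward (∑ i ∈ s, c i) h F = ∑ i ∈ s, pushforward (c i) h F := by
  funext α
  rw [Finset.sum_apply]
  exact map_sum _ _ _

/-- Reduces statements linear in the chain to a single lifted simplex, where the Leibniz rule
applies. -/
theorem TwistedChain.induction {m : ℕ} {p : TwistedChain D m → Prop} (zero : p 0)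
    (add : ∀ c c', p c → p c' → p (c + c')) (smul : ∀ (z : ℤ) c, p c → p (z • c))
    (simplex : ∀ σ, p (simplexChain σ)) (c : TwistedChain D m) : p c := by
  obtain ⟨b, rfl⟩ := Submodule.mkQ_surjective _ c
  induction b using Finsupp.induction_linear with
  | zero => rwa [map_zero]
  | add x y hx hy => rw [map_add]; exact add _ _ hx hy
  | single σ z =>
    have h := smul z _ (simplex σ)
    rwa [simplexChain, ← map_zsmul, Finsupp.smul_single, smul_eq_mul, mul_one] at h

theorem twistedBoundary_simplexChain {m : ℕ} (σ : Sing (m + 1) D.total) :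
    twistedBoundary D m (simplexChain σ)
      = ∑ i : Fin (m + 2), (-1 : ℤ) ^ (i : ℕ) • simplexChain (σ.comp (simplexMap i.succAbove)) := by
  simp only [twistedBoundary, simplexChain, Submodule.mkQ_apply, Submodule.mapQ_apply, singularBoundary,
    Finsupp.linearCombination_single, one_smul]
  rw [← Submodule.mkQ_apply, map_sum]
  simp only [map_zsmul, Submodule.mkQ_apply]

theorem coboundary_add {k : ℕ} (φ ψ : Cochain A B k) :
    coboundary (φ + ψ) = coboundary φ + coboundary ψ := by
  funext α
  simp [coboundary, smul_add, Finset.sum_add_distrib]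

theorem coboundary_zero {k : ℕ} : coboundary (0 : Cochain A B k) = 0 := by
  funext α
  simp [coboundary]

theorem coboundary_smul {k : ℕ} (z : ℤ) (φ : Cochain A B k) :
    coboundary (z • φ) = z • coboundary φ := by
  funext α
  simp only [coboundary, Pi.smul_apply, Finset.smul_sum]
  refine Finset.sum_congr rfl fun i _ => ?_
  rw [smul_comm _ z, smul_comm _ z]

/-- Stokes' formula for the integration of closed cochains over a chain of positive degree. -/
theorem coboundary_pushforward {d m n : ℕ} {F : ProductCochain A B D n} (hF : F.IsClosed)
    (hd : d + (m + 1) = n) (hd' : d + 1 + m = n) (c : TwistedChain D (m + 1)) :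
    coboundary (pushforward c hd F) = -pushforward (twistedBoundary D m c) hd' F := by
  induction c using TwistedChain.induction with
  | zero => rw [pushforward_zero, coboundary_zero, map_zero, pushforward_zero, neg_zero]
  | add c c' h h' =>
    rw [pushforward_add, coboundary_add, map_add, pushforward_add, neg_add, h, h']
  | smul z c h => rw [pushforward_smul, coboundary_smul, map_zsmul, pushforward_smul, h, smul_neg]
  | simplex σ =>
    funext α
    have h1 := chainSum_faceSum (D := d + 1) (M := m + 1) (by omega) (chainValue F α σ)
    rw [chainSum_faceSum_chainValue F hF] at h1
    simp only [chainSum_chainValue_fst, chainSum_chainValue_snd] at h1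
    rw [twistedBoundary_simplexChain, pushforward_sum, Pi.neg_apply, Finset.sum_apply]
    simp only [coboundary, pushforward_smul, Pi.smul_apply, pushforward_simplexChain]
    -- The sign `(-1)^(d+1)` of the coboundary meets the Leibniz sign for `Δ^(d+1)`, and their
    -- product is `1`.
    rw [eq_neg_of_add_eq_zero_left h1.symm, smul_neg, smul_smul, ← mul_pow]
    simp

/-- Stokes' formula in lowest degree: a closed cochain vanishes on boundaries. -/
theorem pushforward_twistedBoundary {m n : ℕ} {F : ProductCochain A B D n} (hF : F.IsClosed)
    (hd : 0 + m = n) (c : TwistedChain D (m + 1)) :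
    pushforward (twistedBoundary D m c) hd F = 0 := by
  induction c using TwistedChain.induction with
  | zero => rw [map_zero, pushforward_zero]
  | add c c' h h' => rw [map_add, pushforward_add, h, h', add_zero]
  | smul z c h => rw [map_zsmul, pushforward_smul, h, smul_zero]
  | simplex σ =>
    funext α
    -- The groupoid factor is a point and has no faces, so only the boundary of `σ` remains.
    have h1 := chainSum_faceSum (D := 0) (M := m + 1) (by omega) (chainValue F α σ)
    rw [chainSum_faceSum_chainValue F hF] at h1
    simp only [chainSum_chainValue_snd, chainSum_zero_left, smul_zero, Finset.sum_const_zero,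
      zero_add, pow_zero, one_smul] at h1
    rw [twistedBoundary_simplexChain, pushforward_sum, Finset.sum_apply]
    simp only [pushforward_smul, Pi.smul_apply, pushforward_simplexChain]
    exact h1.symm

/-- The sum of a closed cochain over points is closed. -/
theorem coboundary_pushforward_degree_zero {d n : ℕ} {F : ProductCochain A B D n} (hF : F.IsClosed)
    (hd : d + 0 = n) (c : TwistedChain D 0) : coboundary (pushforward c hd F) = 0 := by
  induction c using TwistedChain.induction with
  | zero => rw [pushforward_zero, coboundary_zero]
  | add c c' h h' => rw [pushforward_add, coboundary_add, h, h', add_zero]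
  | smul z c h => rw [pushforward_smul, coboundary_smul, h, smul_zero]
  | simplex σ =>
    funext α
    -- Now the space factor is a point, and only the faces of `α` remain.
    have h1 := chainSum_faceSum (D := d + 1) (M := 0) (by omega) (chainValue F α σ)
    rw [chainSum_faceSum_chainValue F hF] at h1
    simp only [chainSum_chainValue_fst, chainSum_zero_right, smul_zero, Finset.sum_const_zero,
      add_zero] at h1
    simp only [coboundary, pushforward_simplexChain]
    rw [← h1, smul_zero]
    rfl

/-- A simplex is nonempty, so none is supported in the empty set. This turns relative cycles of a
closed manifold into cycles. -/
theorem supportedIn_empty (m : ℕ) : supportedIn D m ∅ = ⊥ := by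
  rw [supportedIn, Submodule.span_eq_bot]
  rintro _ ⟨σ, hσ, -⟩
  exact (hσ (stdSimplex.vertex 0)).elim

end CrossProduct

/-! ### Naturality of transgression and the main theorem -/

section Transgression

open CategoryTheory

variable {A : Type} [AddCommGroup A] {X N : Type u} [TopologicalSpace X] [TopologicalSpace N]
  {D : DoubleCover X} {D' : DoubleCover N} {G : Type} [Group G] {π : G →* ℤˣ} {n : ℕ}

theorem isClosed_evPullback (t : FibrePoints π D) {lam : GroupCochain G A n}
    (h : IsTwistedCocycle π lam) : (evPullback t lam).IsClosed :=
  sum_evPullback_face t h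

theorem twistedMap_simplexChain {j : C(N, X)} (h : DoubleCover.Over j D' D) {m : ℕ}
    (σ : Sing m D'.total) :
    twistedMap h m (simplexChain σ) = simplexChain (h.lift.comp σ) := by
  simp [twistedMap, simplexChain, singularMap, Finsupp.mapDomain_single]

/-- Transgression is natural with respect to restriction of bundles. -/
theorem transgression_twistedMap {j : C(N, X)} (h : DoubleCover.Over j D' D) {t : FibrePoints π D}
    {s : FibrePoints π D'} (hts : FibrePoints.Compatible h t s) {d m : ℕ} (hd : d + m = n)
    (lam : GroupCochain G A n) (b : TwistedChain D' m) :
    transgression t (twistedMap h m b) hd lam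
      = Cochain.pullback (restrictFunctor π h) (transgression s b hd lam) := by
  unfold transgression
  induction b using TwistedChain.induction with
  | zero =>
    rw [map_zero, pushforward_zero, pushforward_zero]
    rfl
  | add c c' hc hc' =>
    rw [map_add, pushforward_add, pushforward_add, hc, hc']
    rfl
  | smul z c hc =>
    rw [map_zsmul, pushforward_smul, pushforward_smul, hc]
    rfl
  | simplex σ =>
    funext α
    rw [twistedMap_simplexChain, pushforward_simplexChain]
    refine Eq.trans ?_ (pushforward_simplexChain hd _ _ _).symm
    -- Both sides are sums over the same shuffles with the same signs, so naturality of `ev^*` is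
    -- applied term by term.
    refine Fintype.sum_congr _ _ fun φ => congrArg _ ?_
    exact (evPullback_restrict h hts lam (nerveComp (fun i => (φ.1 i).1) φ.monotone_fst α)
      (σ.comp (simplexMap fun i => (φ.1 i).2))).symm

end Transgression

end
end OrTransgression

theorem proposition3p10 {G : Type} [Group G] [Finite G] (π : G →* ℤˣ) {n : ℕ}
    (lam : GroupCochain G (Additive ℂˣ) n) (hlam : IsTwistedCocycle π lam) :
    -- a compact smooth `(m + 1)`-manifold `M` with boundary `j : N → M`
    (∀ {m : ℕ} (M : Type u) [TopologicalSpace M] [T2Space M] [CompactSpace M]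
      [ChartedSpace (EuclideanHalfSpace (m + 1)) M] [IsManifold (𝓡∂ (m + 1)) ∞ M]
      (N : Type u) [TopologicalSpace N]
      [ChartedSpace (EuclideanSpace ℝ (Fin m)) N] [IsManifold (𝓡 m) ∞ N]
      (j : C(N, M)) (_ : Manifold.IsSmoothEmbedding (𝓡 m) (𝓡∂ (m + 1)) ∞ j)
      (_ : Set.range j = (𝓡∂ (m + 1)).boundary M)
      (h : DoubleCover.Over j (orientationCover (𝓡 m) N) (orientationCover (𝓡∂ (m + 1)) M))
      (c : TwistedChain (orientationCover (𝓡∂ (m + 1)) M) (m + 1))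
      (_ : IsFundamentalChain (𝓡∂ (m + 1)) M c)
      (b : TwistedChain (orientationCover (𝓡 m) N) m)
      (_ : IsFundamentalChain (𝓡 m) N b)
      (_ : twistedBoundary _ m c = twistedMap h m b)
      (t : FibrePoints π (orientationCover (𝓡∂ (m + 1)) M))
      (s : FibrePoints π (orientationCover (𝓡 m) N))
      (_ : FibrePoints.Compatible h t s),
      (∀ (d : ℕ) (hd : d + (m + 1) = n) (hd' : d + 1 + m = n),
        coboundary (transgression t c hd lam) =
          -Cochain.pullback (restrictFunctor π h) (transgression s b hd' lam)) ∧
      (∀ hd : 0 + m = n,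
        -Cochain.pullback (restrictFunctor π h) (transgression s b hd lam) = 0)) ∧
    -- a closed smooth `m`-manifold `M`
    (∀ {m : ℕ} {H : Type*} [TopologicalSpace H]
      (I : ModelWithCorners ℝ (EuclideanSpace ℝ (Fin m)) H)
      (M : Type u) [TopologicalSpace M] [T2Space M] [CompactSpace M]
      [ChartedSpace H M] [IsManifold I ∞ M] [BoundarylessManifold I M]
      (c : TwistedChain (orientationCover I M) m) (_ : IsFundamentalChain I M c)
      (t : FibrePoints π (orientationCover I M)) (d : ℕ) (hd : d + m = n),
      coboundary (transgression t c hd lam) = 0) := by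
  refine ⟨?_, ?_⟩
  · intro m M _ _ _ _ _ N _ _ _ j _ _ h c _ b _ hcb t s hts
    refine ⟨fun d hd hd' => ?_, fun hd => ?_⟩
    · rw [← transgression_twistedMap h hts hd' lam b, ← hcb]
      exact coboundary_pushforward (isClosed_evPullback t hlam) hd hd' c
    · rw [← transgression_twistedMap h hts hd lam b, ← hcb, neg_eq_zero]
      exact pushforward_twistedBoundary (isClosed_evPullback t hlam) hd c
  · intro m H _ I M _ _ _ _ _ _ c hc t d hd
    -- In dimension zero the cycle condition is empty, and closedness of `ev^* λ` alone suffices.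
    cases m with
    | zero => exact coboundary_pushforward_degree_zero (isClosed_evPullback t hlam) hd c
    | succ m =>
      have hc0 : twistedBoundary (orientationCover I M) m c = 0 := by
        have h1 : twistedBoundary (orientationCover I M) m c
            ∈ supportedIn (orientationCover I M) m (I.boundary M) := hc.1
        rwa [ModelWithCorners.Boundaryless.boundary_eq_empty, supportedIn_empty,
          Submodule.mem_bot] at h1
      refine (coboundary_pushforward (isClosed_evPullback t hlam) hd (by omega) c).trans ?_
      rw [hc0, pushforward_zero, neg_zero]
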